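/- Notation. Let $\partial=d/dt$. A $2\times2$ matrix of (complex) Borel measures $W$ on $\mathbb R$ is called a weight matrix if $W(\Omega)$ is positive semidefinite for every Borel set $\Omega$, all moments $\int t^n\,dW(t)$, $n\ge 0$, exist and are finite, and $\int P\,dW\,P^*$ is nonsingular for every matrix polynomial $P\in\mathbb C^{2\times 2}[t]$ with nonsingular leading coefficient. Put $\langle P,Q\rangle_W=\int P(t)\,dW(t)\,Q(t)^*$. An operator $D=\partial^2F_2(t)+\partial^1F_1(t)+\partial^0F_0$ with matrix polynomial coefficients acts on the right by $PD=P''F_2+P'F_1+PF_0$; it is symmetric with respect to $W$ if $\langle PD,Q\rangle_W=\langle P,QD\rangle_W$ for all matrix polynomials $P,Q$; and $\Upsilon(D)$ is the set of weight matrices with respect to which $D$ is symmetric. Let $a\in\mathbb R\setminus\{0\}$ and $W_a(t)=e^{-t^2}\begin{pmatrix}1+a^2t^2&at\\at&1\end{pmatrix}$, $t\in\mathbb R$ (identified with the matrix of measures $W_a(t)\,dt$). **Theorem.** (1) Let $t_0\in\mathbb R$ and $\xi^\pm=\xi^{\pm}_{a,t_0}=\frac12\left(at_0\pm\sqrt{4+a^2t_0^2}\right)$.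 For either choice of sign (upper signs throughout, or lower signs throughout), let $$M(a,t_0)=\begin{pmatrix}(\xi^\pm)^2&\xi^\pm\\ \xi^\pm&1\end{pmatrix}$$ and let $D_{a,t_0}=\partial^2F_2(t)+\partial^1F_1(t)+\partial^0F_0$ with $$F_2(t)=\begin{pmatrix}-\xi^\mp+at_0-at&-1-a^2t_0t+a^2t^2\\-1&-\xi^\mp+at\end{pmatrix},$$ $$F_1(t)=\begin{pmatrix}-2a+2\xi^\mp t&-2t_0-2a\xi^\mp+2(2+a^2)t\\2t_0&2(\xi^\mp-at_0)t\end{pmatrix},$$ $$F_0=\begin{pmatrix}\xi^\mp+\frac{2t_0}{a}&\frac{2(2+a^2)}{a^2}\\ \frac4{a^2}&-\xi^\mp-\frac{2t_0}{a}\end{pmatrix}.$$ Then $M(a,t_0)$ is positive semidefinite of rank one; $D_{a,t_0}$ is symmetric with respect to $\gamma W_a+\zeta\delta_{t_0}M(a,t_0)$ for all $\gamma>0$, $\zeta\ge0$; and $$\Upsilon(D_{a,t_0})=\{\gamma W_a+\zeta\delta_{t_0}M(a,t_0):\ \gamma>0,\ \zeta\ge0\}.$$ Moreover, for all $\gamma>0$,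 $\zeta\ge0$ there is a unique sequence $(P_n)_{n\ge0}$ of monic matrix polynomials, $\deg P_n=n$, orthogonal with respect to $\gamma W_a+\zeta\delta_{t_0}M(a,t_0)$, and it satisfies $P_nD_{a,t_0}=\Gamma_nP_n$ for $n\ge0$, where $$\Gamma_n=\begin{pmatrix}(2n+1)\xi^\mp+\frac{2t_0}{a}&\frac{(2+na^2)(2+(n+1)a^2)}{a^2}\\ \frac4{a^2}&(2n-1)\xi^\mp-2nat_0-\frac{2t_0}{a}\end{pmatrix}$$ does not depend on $\gamma,\zeta$. (2) For $t_0=0$ and the upper signs, $D_{a,0}$ is the operator $$D_a=\partial^2\begin{pmatrix}1-at&-1+a^2t^2\\-1&1+at\end{pmatrix}+\partial^1\begin{pmatrix}-2a-2t&2a+2(2+a^2)t\\0&-2t\end{pmatrix}+\partial^0\begin{pmatrix}-1&2\frac{2+a^2}{a^2}\\ \frac4{a^2}&1\end{pmatrix},$$ $M(a,0)=\begin{pmatrix}1&1\\1&1\end{pmatrix}$, and $\Gamma_n=\begin{pmatrix}-(2n+1)&\frac{(2+na^2)(2+(n+1)a^2)}{a^2}\\ \frac4{a^2}&-2n+1\end{pmatrix}$;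 in particular $$\Upsilon(D_a)=\left\{\gamma W_a+\zeta\delta_0\begin{pmatrix}1&1\\1&1\end{pmatrix}:\ \gamma>0,\ \zeta\ge0\right\}.$$ -/

import Mathlib

open MeasureTheory Polynomial
open scoped ComplexOrder Matrix

noncomputable section

/-- A matrix of (finite, complex-valued) Borel measures on the real line. -/
abbrev MatrixMeasure (n : Type*) := Matrix n n (ComplexMeasure ℝ)

/-- Matrix polynomials: polynomials with coefficients in the complex `n × n` matrices; the
variable commutes with the coefficients. -/
abbrev MatPoly (n : Type*) [Fintype n] [DecidableEq n] := Polynomial (Matrix n n ℂ)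

section General

variable {n : Type*} [Fintype n] [DecidableEq n]

/-- The value `P(t)` of a matrix polynomial at a real point `t`. -/
def MatPoly.value (P : MatPoly n) (t : ℝ) : Matrix n n ℂ :=
  P.eval (algebraMap ℝ (Matrix n n ℂ) t)

/-- The numerical matrix `W(Ω)`. -/
def MatrixMeasure.onSet (W : MatrixMeasure n) (s : Set ℝ) : Matrix n n ℂ :=
  Matrix.of fun i j => W i j s

/-- The integral of a complex function against a complex measure. -/
def complexIntegral (μ : ComplexMeasure ℝ) (f : ℝ → ℂ) : ℂ :=
  VectorMeasure.integral μ f (ContinuousLinearMap.mul ℝ ℂ)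

/-- The matrix-valued form `⟨P, Q⟩ = ∫ P(t) dW(t) Q(t)^*`. -/
def MatrixMeasure.form (W : MatrixMeasure n) (P Q : MatPoly n) : Matrix n n ℂ :=
  Matrix.of fun i j =>
    ∑ k, ∑ l, complexIntegral (W k l) fun t => P.value t i k * star (Q.value t j l)

/-- Weight matrices: `W(Ω)` is positive semidefinite for every Borel set `Ω`, all moments
`∫ tᵐ dW(t)` exist, and `∫ P dW P^*` is nonsingular whenever the leading coefficient of `P` is
nonsingular. -/
structure IsWeightMatrix (W : MatrixMeasure n) : Prop where
  posSemidef : ∀ s : Set ℝ, MeasurableSet s → (W.onSet s).PosSemidef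
  moments : ∀ (m : ℕ) (i j : n), (W i j).Integrable fun t : ℝ => (t : ℂ) ^ m
  nonsingular : ∀ P : MatPoly n, IsUnit P.leadingCoeff → IsUnit (W.form P P)

/-- The coefficients of a right-hand side differential operator `∂² F₂(t) + ∂¹ F₁(t) + ∂⁰ F₀`. -/
@[ext]
structure SecondOrderOp (n : Type*) [Fintype n] [DecidableEq n] where
  F2 : MatPoly n
  F1 : MatPoly n
  F0 : MatPoly n

/-- The right-hand side action `P D = P'' F₂ + P' F₁ + P F₀`. -/
def SecondOrderOp.act (D : SecondOrderOp n) (P : MatPoly n) : MatPoly n :=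
  derivative (derivative P) * D.F2 + derivative P * D.F1 + P * D.F0

/-- `D` is symmetric with respect to `W`: `⟨P D, Q⟩ = ⟨P, Q D⟩` for all matrix polynomials. -/
def SecondOrderOp.IsSymmetric (D : SecondOrderOp n) (W : MatrixMeasure n) : Prop :=
  ∀ P Q : MatPoly n, W.form (D.act P) Q = W.form P (D.act Q)

/-- `Υ(D)`: the weight matrices with respect to which `D` is symmetric. -/
def SecondOrderOp.upsilon (D : SecondOrderOp n) : Set (MatrixMeasure n) :=
  {W | IsWeightMatrix W ∧ D.IsSymmetric W}

/-- `P` is a sequence of monic matrix polynomials, `deg (P m) = m`, orthogonal with respect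
to `W`. -/
def IsMonicOrthogonal (W : MatrixMeasure n) (P : ℕ → MatPoly n) : Prop :=
  (∀ m, (P m).Monic ∧ (P m).natDegree = m) ∧ ∀ m k, m ≠ k → W.form (P m) (P k) = 0

/-- The matrix of measures `δ_{t₀} M`. -/
def diracMass (t₀ : ℝ) (M : Matrix n n ℂ) : MatrixMeasure n :=
  Matrix.of fun i j => VectorMeasure.dirac t₀ (M i j)

end General

/-- A real `2 × 2` matrix with rows `(x, y)`, `(z, w)`, regarded as a complex matrix. -/
def cmat (x y z w : ℝ) : Matrix (Fin 2) (Fin 2) ℂ :=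
  (!![x, y; z, w]).map Complex.ofReal

/-- The density `e^{-t²} (1 + a² t², a t; a t, 1)`. -/
def hermiteDensity (a t : ℝ) : Matrix (Fin 2) (Fin 2) ℂ :=
  Real.exp (-t ^ 2) • cmat (1 + a ^ 2 * t ^ 2) (a * t) (a * t) 1

/-- The matrix of measures `W_a(t) dt`. -/
def hermiteWeight (a : ℝ) : MatrixMeasure (Fin 2) :=
  Matrix.of fun i j => (volume : Measure ℝ).withDensityᵥ fun t => hermiteDensity a t i j

/-- `ξ^±_{a,t₀} = (a t₀ ± √(4 + a² t₀²)) / 2`, where the sign `±` is `s = ±1`. -/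
def hermiteXi (a t₀ s : ℝ) : ℝ := (a * t₀ + s * Real.sqrt (4 + a ^ 2 * t₀ ^ 2)) / 2

/-- The mass `M(a, t₀)`, built from `ξ^±` with `± = s`. -/
def hermiteMass (a t₀ s : ℝ) : Matrix (Fin 2) (Fin 2) ℂ :=
  cmat (hermiteXi a t₀ s ^ 2) (hermiteXi a t₀ s) (hermiteXi a t₀ s) 1

/-- The operator `D_{a,t₀}`, built from `ξ^∓` (the sign opposite to the one in the mass), with
coefficients sorted by powers of the variable. -/
def hermiteOp (a t₀ s : ℝ) : SecondOrderOp (Fin 2) :=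
  let x := hermiteXi a t₀ (-s)
  { F2 := C (cmat (-x + a * t₀) (-1) (-1) (-x))
          + C (cmat (-a) (-(a ^ 2 * t₀)) 0 a) * X
          + C (cmat 0 (a ^ 2) 0 0) * X ^ 2
    F1 := C (cmat (-2 * a) (-2 * t₀ - 2 * a * x) (2 * t₀) 0)
          + C (cmat (2 * x) (2 * (2 + a ^ 2)) 0 (2 * (x - a * t₀))) * X
    F0 := C (cmat (x + 2 * t₀ / a) (2 * (2 + a ^ 2) / a ^ 2)
          (4 / a ^ 2) (-x - 2 * t₀ / a)) }

/-- The eigenvalue `Γ_m`, that is `m (m - 1) F₂² + m F₁¹ + F₀` with `F₂²`, `F₁¹` the leading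
coefficients of `F₂`, `F₁`. -/
def hermiteEigenvalue (a t₀ s : ℝ) (m : ℕ) : Matrix (Fin 2) (Fin 2) ℂ :=
  let x := hermiteXi a t₀ (-s)
  cmat ((2 * m + 1) * x + 2 * t₀ / a)
    ((2 + m * a ^ 2) * (2 + (m + 1) * a ^ 2) / a ^ 2)
    (4 / a ^ 2)
    ((2 * m - 1) * x - 2 * m * (a * t₀) - 2 * t₀ / a)

/-- The operator `D_a` with its mass at the origin. -/
def hermiteOpZero (a : ℝ) : SecondOrderOp (Fin 2) where
  F2 := C (cmat 1 (-1) (-1) 1) + C (cmat (-a) 0 0 a) * X + C (cmat 0 (a ^ 2) 0 0) * X ^ 2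
  F1 := C (cmat (-2 * a) (2 * a) 0 0) + C (cmat (-2) (2 * (2 + a ^ 2)) 0 (-2)) * X
  F0 := C (cmat (-1) (2 * ((2 + a ^ 2) / a ^ 2)) (4 / a ^ 2) 1)

/-- The eigenvalues `Γ_{m,a}` of `D_a`. -/
def hermiteEigenvalueZero (a : ℝ) (m : ℕ) : Matrix (Fin 2) (Fin 2) ℂ :=
  cmat (-(2 * m + 1)) ((2 + m * a ^ 2) * (2 + (m + 1) * a ^ 2) / a ^ 2)
    (4 / a ^ 2) (-2 * m + 1)

end

/-! For monomials $X^m$, $X^k$ with $m+k=N$, symmetry of $D$ reads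
$m(m-1)G_2+mG_1+G_0=(k(k-1)G_2+kG_1+G_0)^*$, where $G_j$ pairs $F_j$ with $X^{N-j}$. For fixed $N$
both sides are quadratic in $m$, so symmetry amounts to moment equations of orders two, one and
zero.

Write $x=\xi^\mp$, $y=\xi^\pm$, so that $x+y=at_0$ and $xy=-1$, and let $\alpha_n,\beta_n,\delta_n$
be the entries $(0,0),(0,1),(1,1)$ of the $n$-th moment. The second-order equations make $\beta_n$
real and express $\alpha_n$ through $\beta$ and $\delta$. The first-order ones then show that the
defect $b_n=\beta_n-a\delta_{n+1}$ is geometric, $b_{n+1}=t_0b_n$ (`hermite_shift`). This defect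
vanishes for $W_a$ and equals $\zeta(y-at_0)t_0^n=-x\zeta t_0^n$ for $\zeta\delta_{t_0}M$. What
remains is the Gaussian moment recurrence for $\delta_n$ with a source of ratio $t_0$
(`hermite_recurrence`). Two real parameters are left, so all moments are those of some $\gamma
W_a+\zeta\delta_{t_0}M$ (`exists_moment_eq_of_moment_equations`). Conversely, these moments satisfy
all the equations, including those of order zero.

The moments determine the weight: for each vector $v$, $v^*Wv$ is a positive scalar measure whose
moments are those of a combination of measures with all exponential moments, so
`measure_ext_of_moments` identifies it, and polarization recovers $W$. The signs of $\gamma,\zeta$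
come from positivity on and off $\{t_0\}$ and from nonsingularity of the form.

Finally $D$ is symmetric and does not raise degrees, so $P_nD-\Gamma_nP_n$ has degree below $n$ and
is orthogonal to all lower $P_k$; hence it vanishes. Comparing leading coefficients gives
$\Gamma_n$, which therefore does not involve the weight. -/

noncomputable section

/-! ### Integration against complex measures -/

theorem complexIntegral_const_mul (μ : ComplexMeasure ℝ) (c : ℂ) (f : ℝ → ℂ) :
    complexIntegral μ (fun t => c * f t) = c * complexIntegral μ f := by
  refine setToFun_smul (𝕜 := ℂ) (dominatedFinMeasAdditive_cbmApplyMeasure μ _)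
    (fun c s x => ?_) c f
  simp [transpose_eq_cbmApplyMeasure, mul_assoc]

theorem integrable_smul_complexMeasure {μ : ComplexMeasure ℝ} {f : ℝ → ℂ}
    (hf : μ.Integrable f) (c : ℂ) : (c • μ).Integrable f := by
  apply Integrable.mono_measure (Integrable.smul_measure_nnreal hf (c := ‖c‖₊))
  simp [VectorMeasure.variation_smul]

/-- The scalar can be moved from the measure to the bilinear pairing, and then to the integrand. The
two set functions agree; only the dominating variation changes, by the factor `‖c‖`. -/
theorem complexIntegral_smul_measure (c : ℂ) {μ : ComplexMeasure ℝ} {f : ℝ → ℂ}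
    (hf : μ.Integrable f) :
    complexIntegral (c • μ) f = c * complexIntegral μ f := by
  have h1 := VectorMeasure.integral_continuousLinearMap_comp (μ := μ) (f := f)
    (B := ContinuousLinearMap.mul ℝ ℂ) (C := ContinuousLinearMap.mul ℝ ℂ c) hf
  have h2 := complexIntegral_const_mul μ c f
  unfold complexIntegral at h2 ⊢
  rw [← h2]
  simp only [ContinuousLinearMap.mul_apply'] at h1
  rw [h1, VectorMeasure.integral_eq_setToFun, VectorMeasure.integral_eq_setToFun]
  have hv : (c • μ).variation = ‖c‖₊ • μ.variation := by simp [VectorMeasure.variation_smul]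
  have hT : ((c • μ).transpose (ContinuousLinearMap.mul ℝ ℂ) : Set ℝ → ℂ →L[ℝ] ℂ) =
      μ.transpose (ContinuousLinearMap.mul ℝ ℂ ∘L ContinuousLinearMap.mul ℝ ℂ c) := by
    ext s : 1
    rw [transpose_eq_cbmApplyMeasure, transpose_eq_cbmApplyMeasure]
    refine ContinuousLinearMap.ext fun x => ?_
    simp [mul_assoc, mul_left_comm]
  have hD := dominatedFinMeasAdditive_cbmApplyMeasure (c • μ) (ContinuousLinearMap.mul ℝ ℂ)
  have hD' := dominatedFinMeasAdditive_cbmApplyMeasure μ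
    (ContinuousLinearMap.mul ℝ ℂ ∘L ContinuousLinearMap.mul ℝ ℂ c)
  rw [hT] at hD
  rw [setToFun_congr_left _ hD hT]
  rw [setToFun_congr_measure_of_integrable (μ := μ.variation) ‖c‖₊ (by simp) (by rw [hv]; rfl)
    hD' hD f hf]

/-- The variation is the least measure dominating `‖c s‖`, and here `‖c s‖` is already a measure. -/
theorem variation_eq_of_nonneg {c : ComplexMeasure ℝ} {μ : Measure ℝ} [IsFiniteMeasure μ]
    (h : ∀ s, MeasurableSet s → c s = (μ.real s : ℂ)) : c.variation = μ := by
  have key : ∀ s, MeasurableSet s → ‖c s‖ₑ = μ s := fun s hs => by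
    rw [h s hs, ← ofReal_norm, Complex.norm_real, Real.norm_of_nonneg measureReal_nonneg,
      ofReal_measureReal]
  refine le_antisymm (VectorMeasure.variation_le_of_forall_enorm_le fun s hs => (key s hs).le) ?_
  exact Measure.le_iff.2 fun s hs => (key s hs).ge.trans
    (VectorMeasure.enorm_measure_le_variation c s)

theorem complexIntegral_eq_integral {c : ComplexMeasure ℝ} {μ : Measure ℝ} [IsFiniteMeasure μ]
    (h : ∀ s, MeasurableSet s → c s = (μ.real s : ℂ)) (f : ℝ → ℂ) :
    complexIntegral c f = ∫ t, f t ∂μ := by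
  unfold complexIntegral
  have hv := variation_eq_of_nonneg h
  rw [VectorMeasure.integral_eq_setToFun, MeasureTheory.integral_eq_setToFun]
  simp only [hv]
  apply setToFun_congr_left' _ _ (fun s hs h's => ?_)
  rw [transpose_eq_cbmApplyMeasure]
  refine ContinuousLinearMap.ext fun x => ?_
  simp [weightedSMul, h s hs, mul_comm]

/-- A complex measure with values in `[0, ∞)` is a finite positive measure. -/
theorem exists_measure_of_nonneg {c : ComplexMeasure ℝ} (h : ∀ s, MeasurableSet s → 0 ≤ c s) :
    ∃ μ : Measure ℝ, IsFiniteMeasure μ ∧ ∀ s, MeasurableSet s → c s = (μ.real s : ℂ) := by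
  have h0 : 0 ≤[Set.univ] ComplexMeasure.re c := by
    refine (VectorMeasure.le_restrict_univ_iff_le _ _).2 fun s hs => ?_
    simpa [ComplexMeasure.re, VectorMeasure.mapRangeₗ] using (Complex.le_def.1 (h s hs)).1
  refine ⟨_, SignedMeasure.toMeasureOfZeroLE_finite (hi₁ := .univ) _ h0, fun s hs => ?_⟩
  rw [SignedMeasure.toMeasureOfZeroLE_real_apply _ h0 .univ hs, Set.univ_inter]
  apply Complex.ext
  · simp [ComplexMeasure.re, VectorMeasure.mapRangeₗ]
  · simpa using (Complex.le_def.1 (h s hs)).2.symm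

theorem withDensityᵥ_ofReal_apply {h : ℝ → ℝ} (hh : Integrable h) {s : Set ℝ}
    (hs : MeasurableSet s) :
    ((volume : Measure ℝ).withDensityᵥ fun t => (h t : ℂ)) s = ((∫ t in s, h t : ℝ) : ℂ) := by
  rw [withDensityᵥ_apply hh.ofReal hs, integral_complex_ofReal]

theorem complexIntegral_withDensity_nonneg {h : ℝ → ℝ} (hh : Integrable h) (h0 : ∀ t, 0 ≤ h t)
    {f : ℝ → ℂ} (hfh : Integrable fun t => f t * h t) :
    (((volume : Measure ℝ).withDensityᵥ fun t => (h t : ℂ))).Integrable f ∧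
      complexIntegral ((volume : Measure ℝ).withDensityᵥ fun t => (h t : ℂ)) f =
        ∫ t, f t * h t := by
  have hfin : IsFiniteMeasure ((volume : Measure ℝ).withDensity fun t => ENNReal.ofReal (h t)) :=
    isFiniteMeasure_withDensity_ofReal hh.2
  have key : ∀ s, MeasurableSet s → ((volume : Measure ℝ).withDensityᵥ fun t => (h t : ℂ)) s =
      ((((volume : Measure ℝ).withDensity fun t => ENNReal.ofReal (h t)).real s : ℝ) : ℂ) := by
    intro s hs
    rw [withDensityᵥ_ofReal_apply hh hs, measureReal_def, withDensity_apply _ hs,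
      integral_eq_lintegral_of_nonneg_ae (.of_forall h0) hh.1.restrict]
  constructor
  · unfold VectorMeasure.Integrable
    rw [variation_eq_of_nonneg key, integrable_withDensity_iff_integrable_smul₀'
      hh.1.aemeasurable.ennreal_ofReal (by simp)]
    refine hfh.congr (.of_forall fun t => ?_)
    simp [ENNReal.toReal_ofReal (h0 t), mul_comm]
  · rw [complexIntegral_eq_integral key, integral_withDensity_eq_integral_toReal_smul₀
      hh.1.aemeasurable.ennreal_ofReal (by simp)]
    refine integral_congr_ae (.of_forall fun t => ?_)
    simp [ENNReal.toReal_ofReal (h0 t), mul_comm]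

/-- The off-diagonal density $at\,e^{-t^2}$ changes sign, so the density is split into positive and
negative parts. -/
theorem complexIntegral_withDensity {h : ℝ → ℝ} (hh : Integrable h)
    {f : ℝ → ℂ} (hf : Continuous f) (hfh : Integrable fun t => f t * h t) :
    (((volume : Measure ℝ).withDensityᵥ fun t => (h t : ℂ))).Integrable f ∧
      complexIntegral ((volume : Measure ℝ).withDensityᵥ fun t => (h t : ℂ)) f =
        ∫ t, f t * h t := by
  have hp : Integrable fun t => max (h t) 0 := hh.pos_part
  have hn : Integrable fun t => max (-h t) 0 := hh.neg_part
  have e : ∀ t, h t = max (h t) 0 - max (-h t) 0 := fun t => by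
    rcases le_total 0 (h t) with h1 | h1 <;> simp [h1]
  have hfp : Integrable fun t => f t * ((max (h t) 0 : ℝ) : ℂ) := by
    refine hfh.mono (hf.aestronglyMeasurable.mul hp.ofReal.1) (.of_forall fun t => ?_)
    rw [norm_mul, norm_mul, Complex.norm_real, Complex.norm_real]
    gcongr
    rcases le_total 0 (h t) with h1 | h1 <;> simp [h1]
  have hfn : Integrable fun t => f t * ((max (-h t) 0 : ℝ) : ℂ) := by
    refine hfh.mono (hf.aestronglyMeasurable.mul hn.ofReal.1) (.of_forall fun t => ?_)
    rw [norm_mul, norm_mul, Complex.norm_real, Complex.norm_real]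
    gcongr
    rcases le_total 0 (h t) with h1 | h1 <;> simp [h1]
  obtain ⟨i1, e1⟩ := complexIntegral_withDensity_nonneg hp (fun t => le_max_right _ _) hfp
  obtain ⟨i2, e2⟩ := complexIntegral_withDensity_nonneg hn (fun t => le_max_right _ _) hfn
  have hd : ((volume : Measure ℝ).withDensityᵥ fun t => (h t : ℂ)) =
      ((volume : Measure ℝ).withDensityᵥ fun t => ((max (h t) 0 : ℝ) : ℂ)) -
      ((volume : Measure ℝ).withDensityᵥ fun t => ((max (-h t) 0 : ℝ) : ℂ)) := by
    rw [← withDensityᵥ_sub' hp.ofReal hn.ofReal]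
    congr 1
    ext t
    rw [← Complex.ofReal_sub, ← e]
  rw [hd]
  refine ⟨i1.sub_vectorMeasure i2, ?_⟩
  unfold complexIntegral at e1 e2 ⊢
  rw [VectorMeasure.integral_sub_vectorMeasure i1 i2, e1, e2, ← integral_sub hfp hfn]
  congr 1
  ext t
  rw [← mul_sub, ← Complex.ofReal_sub, ← e]

/-- Conjugate measures have the same variation, and conjugation is a real-linear map that commutes
with the integral. This is what makes the moments of a Hermitian matrix of measures Hermitian. -/
theorem complexIntegral_conj {μ ν : ComplexMeasure ℝ}
    (h : ∀ s, MeasurableSet s → ν s = star (μ s)) {f : ℝ → ℂ} (hf : μ.Integrable f) :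
    complexIntegral ν f = star (complexIntegral μ fun t => star (f t)) := by
  have hv : ν.variation = μ.variation := by
    have key : ∀ s, MeasurableSet s → ‖ν s‖ₑ = ‖μ s‖ₑ := fun s hs => by
      rw [h s hs, ← ofReal_norm, ← ofReal_norm, norm_star]
    refine le_antisymm (VectorMeasure.variation_le_of_forall_enorm_le fun s hs => ?_)
      (VectorMeasure.variation_le_of_forall_enorm_le fun s hs => ?_)
    · exact (key s hs).le.trans (VectorMeasure.enorm_measure_le_variation _ _)
    · exact (key s hs).ge.trans (VectorMeasure.enorm_measure_le_variation _ _)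
  let K : ℂ →L[ℝ] ℂ := Complex.conjCLE.toContinuousLinearMap
  have hK : ∀ z, K z = star z := fun z => rfl
  have hf' : μ.Integrable fun t => star (f t) := K.integrable_comp hf
  have h1 := VectorMeasure.continuousLinearMap_apply_integral (μ := μ)
    (B := ContinuousLinearMap.mul ℝ ℂ) (C := K) hf'
  have h2 := VectorMeasure.integral_continuousLinearMap_comp (μ := μ) (f := f)
    (B := ContinuousLinearMap.compL ℝ ℂ ℂ ℂ K ∘L ContinuousLinearMap.mul ℝ ℂ) (C := K) hf
  simp only [hK] at h1 h2
  unfold complexIntegral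
  rw [h1, h2, VectorMeasure.integral_eq_setToFun, VectorMeasure.integral_eq_setToFun]
  simp only [hv]
  apply setToFun_congr_left' _ _ (fun s hs h's => ?_)
  rw [transpose_eq_cbmApplyMeasure, transpose_eq_cbmApplyMeasure]
  refine ContinuousLinearMap.ext fun x => ?_
  simp [hK, h s hs]

/-! ### The matrix form, computed through entries and moments -/

section PolynomialIntegral

variable {μ : ComplexMeasure ℝ} (hμ : ∀ m : ℕ, μ.Integrable fun t : ℝ => (t : ℂ) ^ m)

include hμ in
theorem integrable_polynomial (p : ℂ[X]) : μ.Integrable fun t : ℝ => p.eval (t : ℂ) := by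
  induction p using Polynomial.induction_on' with
  | add p q hp hq => simpa using! hp.add hq
  | monomial m c => simpa using! (hμ m).const_mul c

include hμ in
theorem complexIntegral_polynomial_add (p q : ℂ[X]) :
    complexIntegral μ (fun t => (p + q).eval (t : ℂ)) =
      complexIntegral μ (fun t => p.eval (t : ℂ)) + complexIntegral μ (fun t => q.eval (t : ℂ)) := by
  simp only [eval_add]
  exact VectorMeasure.integral_fun_add (integrable_polynomial hμ p) (integrable_polynomial hμ q)

end PolynomialIntegral

section Form

variable {n : Type*} [Fintype n] [DecidableEq n]

/-- The entries of a matrix polynomial. -/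
def MatPoly.entry (P : MatPoly n) (i j : n) : ℂ[X] := matPolyEquiv.symm P i j

theorem MatPoly.value_eq_eval_entry (P : MatPoly n) (t : ℝ) (i j : n) :
    P.value t i j = (P.entry i j).eval (t : ℂ) := by
  rw [MatPoly.entry, ← matPolyEquiv_eval, AlgEquiv.apply_symm_apply, MatPoly.value]
  rfl

theorem MatPoly.entry_coeff (P : MatPoly n) (i j : n) (k : ℕ) :
    (P.entry i j).coeff k = P.coeff k i j := matPolyEquiv_symm_apply_coeff P i j k

theorem MatPoly.entry_add (P Q : MatPoly n) (i j : n) :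
    (P + Q).entry i j = P.entry i j + Q.entry i j := by
  simp [MatPoly.entry]

theorem MatPoly.entry_C_mul (A : Matrix n n ℂ) (P : MatPoly n) (i j : n) :
    MatPoly.entry (C A * P) i j = ∑ k, C (A i k) * P.entry k j := by
  simp [MatPoly.entry, Matrix.mul_apply]

theorem MatPoly.entry_X_pow (m : ℕ) (i j : n) :
    MatPoly.entry (X ^ m : MatPoly n) i j = if i = j then X ^ m else 0 := by
  ext k
  rw [MatPoly.entry_coeff, coeff_X_pow]
  by_cases h : i = j <;> by_cases hk : k = m <;> simp [h, hk, coeff_X_pow, Matrix.one_apply]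

theorem MatPoly.ext_entry {P Q : MatPoly n} (h : ∀ i j, P.entry i j = Q.entry i j) : P = Q :=
  matPolyEquiv.symm.injective (Matrix.ext h)

/-- Existence of all moments. -/
def MatrixMeasure.HasMoments (W : MatrixMeasure n) : Prop :=
  ∀ (m : ℕ) (i j : n), (W i j).Integrable fun t : ℝ => (t : ℂ) ^ m

/-- The moments `∫ tᵐ dW(t)`. -/
def MatrixMeasure.moment (W : MatrixMeasure n) (m : ℕ) : Matrix n n ℂ :=
  Matrix.of fun i j => complexIntegral (W i j) fun t => (t : ℂ) ^ m

/-- The conjugate polynomial. -/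
abbrev conjPoly (p : ℂ[X]) : ℂ[X] := p.map (starRingEnd ℂ)

theorem star_eval_ofReal (p : ℂ[X]) (t : ℝ) : star (p.eval (t : ℂ)) = (conjPoly p).eval (t : ℂ) := by
  rw [conjPoly, eval_map, eval₂_eq_sum_range, eval_eq_sum_range, star_sum]
  simp

theorem MatrixMeasure.form_apply (W : MatrixMeasure n) (P Q : MatPoly n) (i j : n) :
    W.form P Q i j = ∑ k, ∑ l, complexIntegral (W k l)
      fun t => (P.entry i k * conjPoly (Q.entry j l)).eval (t : ℂ) := by
  simp [MatrixMeasure.form, MatPoly.value_eq_eval_entry, star_eval_ofReal]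

variable {W : MatrixMeasure n} (hW : W.HasMoments)

include hW in
theorem MatrixMeasure.form_add_left (P P' Q : MatPoly n) :
    W.form (P + P') Q = W.form P Q + W.form P' Q := by
  ext i j
  simp only [Matrix.add_apply, MatrixMeasure.form_apply, MatPoly.entry_add, add_mul,
    ← Finset.sum_add_distrib]
  refine Finset.sum_congr rfl fun k _ => Finset.sum_congr rfl fun l _ => ?_
  exact complexIntegral_polynomial_add (fun m => hW m k l) _ _

include hW in
theorem MatrixMeasure.form_add_right (P Q Q' : MatPoly n) :
    W.form P (Q + Q') = W.form P Q + W.form P Q' := by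
  ext i j
  simp only [Matrix.add_apply, MatrixMeasure.form_apply, MatPoly.entry_add, mul_add,
    ← Finset.sum_add_distrib, conjPoly, Polynomial.map_add]
  refine Finset.sum_congr rfl fun k _ => Finset.sum_congr rfl fun l _ => ?_
  exact complexIntegral_polynomial_add (fun m => hW m k l) _ _

theorem complexIntegral_polynomial_C_mul (μ : ComplexMeasure ℝ) (c : ℂ) (p : ℂ[X]) :
    complexIntegral μ (fun t => (C c * p).eval (t : ℂ)) =
      c * complexIntegral μ (fun t => p.eval (t : ℂ)) := by
  simp only [eval_mul, eval_C]
  exact complexIntegral_const_mul _ _ _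

theorem complexIntegral_polynomial_sum {μ : ComplexMeasure ℝ}
    (hμ : ∀ m : ℕ, μ.Integrable fun t : ℝ => (t : ℂ) ^ m) {ι : Type*} (s : Finset ι)
    (p : ι → ℂ[X]) :
    complexIntegral μ (fun t => (∑ i ∈ s, p i).eval (t : ℂ)) =
      ∑ i ∈ s, complexIntegral μ (fun t => (p i).eval (t : ℂ)) := by
  simp only [eval_finsetSum]
  exact VectorMeasure.integral_finsetSum _ fun i _ => integrable_polynomial hμ (p i)

include hW in
theorem MatrixMeasure.form_C_mul_left (A : Matrix n n ℂ) (P Q : MatPoly n) :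
    W.form (C A * P) Q = A * W.form P Q := by
  ext i j
  simp only [Matrix.mul_apply, MatrixMeasure.form_apply, MatPoly.entry_C_mul, Finset.sum_mul,
    Finset.mul_sum, mul_assoc, complexIntegral_polynomial_sum (fun m => hW m _ _),
    complexIntegral_polynomial_C_mul]
  symm
  rw [Finset.sum_comm]
  refine Finset.sum_congr rfl fun k _ => ?_
  rw [Finset.sum_comm]

include hW in
theorem MatrixMeasure.form_C_mul_right (A : Matrix n n ℂ) (P Q : MatPoly n) :
    W.form P (C A * Q) = W.form P Q * Aᴴ := by
  ext i j
  simp only [Matrix.mul_apply, MatrixMeasure.form_apply, MatPoly.entry_C_mul, Finset.sum_mul,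
    Finset.mul_sum, conjPoly, Polynomial.map_sum, Polynomial.map_mul, Polynomial.map_C]
  simp only [mul_left_comm _ (C _) _, complexIntegral_polynomial_sum (fun m => hW m _ _),
    complexIntegral_polynomial_C_mul]
  symm
  rw [Finset.sum_comm]
  refine Finset.sum_congr rfl fun k _ => ?_
  rw [Finset.sum_comm]
  refine Finset.sum_congr rfl fun l _ => Finset.sum_congr rfl fun m _ => ?_
  rw [mul_comm]
  rfl

theorem MatrixMeasure.form_X_pow (W : MatrixMeasure n) (m k : ℕ) :
    W.form (X ^ m) (X ^ k) = W.moment (m + k) := by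
  ext i j
  rw [MatrixMeasure.form_apply, Finset.sum_eq_single i, Finset.sum_eq_single j]
  · simp [MatPoly.entry_X_pow, MatrixMeasure.moment, pow_add]
  · intro l _ hl
    simp [MatPoly.entry_X_pow, hl.symm, complexIntegral]
  · simp
  · intro l _ hl
    simp [MatPoly.entry_X_pow, hl.symm, complexIntegral]
  · simp

omit [Fintype n] [DecidableEq n] in
theorem MatrixMeasure.moment_conjTranspose (hW : W.HasMoments)
    (hH : ∀ s, MeasurableSet s → (W.onSet s).IsHermitian) (m : ℕ) :
    (W.moment m)ᴴ = W.moment m := by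
  ext i j
  have := complexIntegral_conj (μ := W j i) (ν := W i j)
    (fun s hs => ((hH s hs).apply i j).symm) (hW m j i)
  simpa [MatrixMeasure.moment] using this.symm

theorem MatrixMeasure.form_conjTranspose (hW : W.HasMoments)
    (hH : ∀ m, (W.moment m)ᴴ = W.moment m) (P Q : MatPoly n) :
    (W.form P Q)ᴴ = W.form Q P := by
  induction P using Polynomial.induction_on' with
  | add P P' hP hP' =>
    rw [form_add_left hW, form_add_right hW, Matrix.conjTranspose_add, hP, hP']
  | monomial m A =>
    induction Q using Polynomial.induction_on' with
    | add Q Q' hP hP' =>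
      rw [form_add_left hW, form_add_right hW, Matrix.conjTranspose_add, hP, hP']
    | monomial k B =>
      simp only [← C_mul_X_pow_eq_monomial, form_C_mul_left hW, form_C_mul_right hW, form_X_pow,
        Matrix.conjTranspose_mul, hH, Matrix.conjTranspose_conjTranspose, mul_assoc, add_comm m k]

end Form

/-! ### Symmetry as a system of moment equations -/

section Symmetry

variable {n : Type*} [Fintype n] [DecidableEq n]

theorem SecondOrderOp.act_add (D : SecondOrderOp n) (P Q : MatPoly n) :
    D.act (P + Q) = D.act P + D.act Q := by
  simp only [SecondOrderOp.act, derivative_add, add_mul]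
  abel

theorem SecondOrderOp.act_C_mul (D : SecondOrderOp n) (A : Matrix n n ℂ) (P : MatPoly n) :
    D.act (C A * P) = C A * D.act P := by
  simp only [SecondOrderOp.act, derivative_C_mul, mul_add, mul_assoc]

variable {W : MatrixMeasure n} (hW : W.HasMoments) (hH : ∀ m, (W.moment m)ᴴ = W.moment m)
  {D : SecondOrderOp n}

include hW in
theorem MatrixMeasure.form_X_pow_mul (m k : ℕ) (P : MatPoly n) :
    W.form (X ^ m * P) (X ^ k) = W.form P (X ^ (m + k)) := by
  induction P using Polynomial.induction_on' with
  | add P P' hP hP' => rw [mul_add, form_add_left hW, form_add_left hW, hP, hP']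
  | monomial j A =>
    rw [← C_mul_X_pow_eq_monomial, ← mul_assoc, (commute_X_pow _ m).eq, mul_assoc, ← pow_add,
      form_C_mul_left hW, form_C_mul_left hW, form_X_pow, form_X_pow]
    ring_nf

-- The truncated exponents `m + k - 2` and `m + k - 1` are harmless: whenever truncation occurs, the
-- scalar in front is zero.
include hW in
theorem SecondOrderOp.form_act_X_pow (m k : ℕ) :
    W.form (D.act (X ^ m)) (X ^ k) =
      ((m : ℂ) * (m - 1)) • W.form D.F2 (X ^ (m + k - 2)) +
        (m : ℂ) • W.form D.F1 (X ^ (m + k - 1)) + W.form D.F0 (X ^ (m + k)) := by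
  have hC : ∀ (c : ℂ) (P : MatPoly n) (N : ℕ),
      W.form (C (c • (1 : Matrix n n ℂ)) * P) (X ^ N) = c • W.form P (X ^ N) := fun c P N => by
    rw [MatrixMeasure.form_C_mul_left hW, smul_mul_assoc, one_mul]
  have h1 : derivative (X ^ m : MatPoly n) = C ((m : ℂ) • 1) * X ^ (m - 1) := by
    rw [derivative_X_pow, ← map_natCast (algebraMap ℂ (Matrix n n ℂ)) m, Algebra.algebraMap_eq_smul_one]
  have h2 : derivative (derivative (X ^ m : MatPoly n)) =
      C (((m : ℂ) * (m - 1)) • 1) * X ^ (m - 2) := by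
    rcases m with _ | m
    · simp
    · rw [h1, derivative_C_mul, derivative_X_pow, ← mul_assoc, ← C_mul, smul_mul_assoc, one_mul,
        Nat.add_sub_cancel, ← map_natCast (algebraMap ℂ (Matrix n n ℂ)) m,
        Algebra.algebraMap_eq_smul_one, smul_smul]
      push_cast
      rw [add_sub_cancel_right]
  rw [SecondOrderOp.act, MatrixMeasure.form_add_left hW, MatrixMeasure.form_add_left hW, h2, h1,
    mul_assoc, mul_assoc, hC, hC, MatrixMeasure.form_X_pow_mul hW,
    MatrixMeasure.form_X_pow_mul hW, MatrixMeasure.form_X_pow_mul hW]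
  rcases m with _ | _ | m
  · simp
  · simp
  · congr 4
    · congr 2; omega
    · congr 2; omega

-- Both sides are sesquilinear over left matrix multiplication, with which the right-hand action of
-- `D` commutes, so monomials suffice.
include hW hH in
theorem SecondOrderOp.isSymmetric_iff :
    D.IsSymmetric W ↔ ∀ m k : ℕ,
      W.form (D.act (X ^ m)) (X ^ k) = (W.form (D.act (X ^ k)) (X ^ m))ᴴ := by
  simp_rw [MatrixMeasure.form_conjTranspose hW hH]
  refine ⟨fun h m k => h _ _, fun h P Q => ?_⟩
  induction P using Polynomial.induction_on' with
  | add P P' hP hP' =>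
    rw [D.act_add, MatrixMeasure.form_add_left hW, MatrixMeasure.form_add_left hW, hP, hP']
  | monomial m A =>
    induction Q using Polynomial.induction_on' with
    | add Q Q' hQ hQ' =>
      rw [D.act_add, MatrixMeasure.form_add_right hW, MatrixMeasure.form_add_right hW, hQ, hQ']
    | monomial k B =>
      rw [← C_mul_X_pow_eq_monomial, ← C_mul_X_pow_eq_monomial, D.act_C_mul, D.act_C_mul,
        MatrixMeasure.form_C_mul_left hW, MatrixMeasure.form_C_mul_left hW,
        MatrixMeasure.form_C_mul_right hW, MatrixMeasure.form_C_mul_right hW, h]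

include hW hH in
/-- The moment form of the symmetry equations of orders two and one. -/
theorem SecondOrderOp.IsSymmetric.moment_equations (h : D.IsSymmetric W) :
    (∀ N : ℕ, (W.form D.F2 (X ^ N))ᴴ = W.form D.F2 (X ^ N)) ∧
    (W.form D.F1 (X ^ 0) + (W.form D.F1 (X ^ 0))ᴴ = 0) ∧
    ∀ N : ℕ, W.form D.F1 (X ^ (N + 1)) + (W.form D.F1 (X ^ (N + 1)))ᴴ =
      (-2 * ((N : ℂ) + 1)) • W.form D.F2 (X ^ N) := by
  rw [SecondOrderOp.isSymmetric_iff hW hH] at h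
  simp only [SecondOrderOp.form_act_X_pow hW] at h
  have key : ∀ N : ℕ, (W.form D.F2 (X ^ N))ᴴ = W.form D.F2 (X ^ N) ∧
      W.form D.F1 (X ^ (N + 1)) + (W.form D.F1 (X ^ (N + 1)))ᴴ =
      (-2 * ((N : ℂ) + 1)) • W.form D.F2 (X ^ N) := by
    intro N
    -- Three splittings of the same total degree `N + 2`. Their second difference shows that `G2` is
    -- Hermitian, and a first difference gives the equation for `G1`.
    have h0 := h 0 (N + 2)
    have h1 := h 1 (N + 1)
    have h2 := h 2 N
    rw [show 0 + (N + 2) = N + 2 by ring, show N + 2 + 0 = N + 2 by ring] at h0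
    rw [show 1 + (N + 1) = N + 2 by ring, show N + 1 + 1 = N + 2 by ring] at h1
    rw [show 2 + N = N + 2 by ring] at h2
    simp only [Nat.add_sub_cancel, show N + 2 - 1 = N + 1 from rfl] at h0 h1 h2
    generalize W.form D.F2 (X ^ N) = G2 at *
    generalize W.form D.F1 (X ^ (N + 1)) = G1 at *
    generalize W.form D.F0 (X ^ (N + 2)) = G0 at *
    have e2 : G2ᴴ = G2 := by
      ext i j
      have h0 := congrFun (congrFun h0 i) j
      have h1 := congrFun (congrFun h1 i) j
      have h2 := congrFun (congrFun h2 i) j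
      simp at h0 h1 h2 ⊢
      linear_combination (-1/2) * (h0 - 2 * h1 + h2)
    refine ⟨e2, ?_⟩
    ext i j
    have h0 := congrFun (congrFun h0 i) j
    have h1 := congrFun (congrFun h1 i) j
    have h2 := congrFun (congrFun h2 i) j
    have e2 := congrFun (congrFun e2 i) j
    simp at h0 h1 h2 e2 ⊢
    linear_combination h1 - h0 - 2 * (N + 1) * e2
  refine ⟨fun N => (key N).1, ?_, fun N => (key N).2⟩
  have h0 := h 0 1
  have h1 := h 1 0
  ext i j
  have h0 := congrFun (congrFun h0 i) j
  have h1 := congrFun (congrFun h1 i) j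
  simp at h0 h1 ⊢
  linear_combination h1 - h0

-- The order-zero hypothesis is the monomial identity with $m=0$, up to $G_2^*=G_2$. The other
-- splittings of the same total degree differ from it by multiples of the equations of orders one
-- and two.
include hW hH in
theorem SecondOrderOp.isSymmetric_of_moment_equations
    (h2 : ∀ N : ℕ, (W.form D.F2 (X ^ N))ᴴ = W.form D.F2 (X ^ N))
    (h1 : W.form D.F1 (X ^ 0) + (W.form D.F1 (X ^ 0))ᴴ = 0)
    (h1' : ∀ N : ℕ, W.form D.F1 (X ^ (N + 1)) + (W.form D.F1 (X ^ (N + 1)))ᴴ =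
      (-2 * ((N : ℂ) + 1)) • W.form D.F2 (X ^ N))
    (h0 : ∀ N : ℕ, W.form D.F0 (X ^ N) - (W.form D.F0 (X ^ N))ᴴ =
      ((N : ℂ) * (N - 1)) • W.form D.F2 (X ^ (N - 2)) +
      (N : ℂ) • (W.form D.F1 (X ^ (N - 1)))ᴴ) :
    D.IsSymmetric W := by
  rw [SecondOrderOp.isSymmetric_iff hW hH]
  intro m k
  simp only [SecondOrderOp.form_act_X_pow hW, add_comm k m]
  have h0 := h0 (m + k)
  rcases hN : m + k with _ | _ | N
  · obtain ⟨rfl, rfl⟩ : m = 0 ∧ k = 0 := by omega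
    simpa [sub_eq_zero] using h0
  · obtain ⟨rfl, rfl⟩ | ⟨rfl, rfl⟩ : (m = 0 ∧ k = 1) ∨ (m = 1 ∧ k = 0) := by omega
    all_goals
      ext i j
      have h0 := congrFun (congrFun h0 i) j
      have h1 := congrFun (congrFun h1 i) j
      simp at h0 h1 ⊢
    · linear_combination h0
    · linear_combination h0 + h1
  · have h1' := h1' N
    have h2 := h2 N
    have hN' : (m : ℂ) + k = N + 2 := by exact_mod_cast hN
    rw [hN] at h0
    simp only [Nat.add_sub_cancel, show N + 2 - 1 = N + 1 from rfl, add_assoc, Nat.reduceAdd] at h0 ⊢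
    have hk : (k : ℂ) = N + 2 - m := by linear_combination hN'
    ext i j
    have h0 := congrFun (congrFun h0 i) j
    have h1' := congrFun (congrFun h1' i) j
    have h2 := congrFun (congrFun h2 i) j
    simp at h0 h1' h2 ⊢
    rw [hk]
    linear_combination h0 + m * h1' - (N + 2 - m) * (N + 2 - m - 1) * h2

end Symmetry

/-! ### Solving the moment equations of the Hermite operator -/

/-- Hermitian symmetry of the $(1,1)$ entry of the second-order expression leaves only $\beta_n$
free to be non-real, so $\beta_n$ is real. The $(0,1)$ entry can then be solved for $\alpha_n$. -/
theorem hermite_entry_equations {a t₀ x : ℝ} {S : ℕ → Matrix (Fin 2) (Fin 2) ℂ}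
    (hS : ∀ n, (S n).IsHermitian)
    (h2 : ∀ N, (cmat (-x + a * t₀) (-1) (-1) (-x) * S N
        + cmat (-a) (-(a ^ 2 * t₀)) 0 a * S (N + 1) + cmat 0 (a ^ 2) 0 0 * S (N + 2)).IsHermitian)
    (n : ℕ) :
    S n 1 0 = S n 0 1 ∧
    S n 0 0 = a * (2 * S (n + 1) 0 1 - t₀ * S n 0 1) + S n 1 1
      + a ^ 2 * t₀ * S (n + 1) 1 1 - a ^ 2 * S (n + 2) 1 1 := by
  have hα : ∀ n, star (S n 0 0) = S n 0 0 := fun n => (hS n).apply 0 0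
  have hδ : ∀ n, star (S n 1 1) = S n 1 1 := fun n => (hS n).apply 1 1
  have hβ' : ∀ n, star (S n 0 1) = S n 1 0 := fun n => (hS n).apply 1 0
  have hβ : ∀ n, S n 1 0 = S n 0 1 := fun n => by
    have := (h2 n).apply 1 1
    simp [cmat, Matrix.mul_apply, Fin.sum_univ_two] at this hδ hβ'
    simp only [hδ, hβ'] at this
    linear_combination -this
  refine ⟨hβ n, ?_⟩
  have := (h2 n).apply 0 1
  simp [cmat, Matrix.mul_apply, Fin.sum_univ_two] at this hα hβ'
  simp only [hα, hβ, hβ'] at this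
  linear_combination -this

theorem hermite_first_order_equations {a t₀ x : ℝ} {S₀ S₁ : Matrix (Fin 2) (Fin 2) ℂ}
    (h₀ : S₀.IsHermitian) (h₁ : S₁.IsHermitian)
    (hβ₀ : S₀ 1 0 = S₀ 0 1) (hβ₁ : S₁ 1 0 = S₁ 0 1) {R G : Matrix (Fin 2) (Fin 2) ℂ}
    (hG : G = cmat (-2 * a) (-2 * t₀ - 2 * a * x) (2 * t₀) 0 * S₀ +
      cmat (2 * x) (2 * (2 + a ^ 2)) 0 (2 * (x - a * t₀)) * S₁)
    (hR : G + Gᴴ = R) :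
    4 * t₀ * S₀ 0 1 + 4 * (x - a * t₀) * S₁ 1 1 = R 1 1 ∧
    -2 * a * S₀ 0 1 + (-2 * t₀ - 2 * a * x) * S₀ 1 1 + 2 * x * S₁ 0 1 + 2 * (2 + a ^ 2) * S₁ 1 1 +
      2 * t₀ * S₀ 0 0 + 2 * (x - a * t₀) * S₁ 0 1 = R 0 1 := by
  have a0 := h₀.apply 0 0
  have b0 := h₀.apply 1 0
  have d1 := h₁.apply 1 1
  have b1 := h₁.apply 1 0
  subst hR hG
  simp [cmat, Matrix.mul_apply, Fin.sum_univ_two] at a0 b0 d1 b1 ⊢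
  simp only [a0, b0, d1, b1, hβ₀, hβ₁]
  constructor <;> ring

/-- Here `g` and `g'` are the right-hand sides from the preceding level. The combination `x * g' -
g` is chosen because $x^2=at_0x+1$ cancels the older moments in it. The same combination of the
left-hand sides, corrected by `h'`, is $x^2+1$ times the claim. -/
theorem hermite_shift {a t₀ x α₀ β₀ β₁ δ₀ δ₁ δ₂ g g' : ℂ} (n : ℂ)
    (hx : x ^ 2 = a * t₀ * x + 1) (hx1 : x ^ 2 + 1 ≠ 0)
    (hα : α₀ = a * (2 * β₁ - t₀ * β₀) + δ₀ + a ^ 2 * t₀ * δ₁ - a ^ 2 * δ₂)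
    (h : 4 * t₀ * β₀ + 4 * (x - a * t₀) * δ₁ = -2 * g)
    (h' : 4 * t₀ * β₁ + 4 * (x - a * t₀) * δ₂ = -2 * (n + 1) * (- β₀ - x * δ₀ + a * δ₁))
    (h'' : -2 * a * β₀ + (-2 * t₀ - 2 * a * x) * δ₀ + 2 * x * β₁ + 2 * (2 + a ^ 2) * δ₁ +
      2 * t₀ * α₀ + 2 * (x - a * t₀) * β₁ = -2 * g')
    (hg : x * g' - g = n * (-a * x * β₀ - a * x ^ 2 * δ₀ + a ^ 2 * x * δ₁)) :
    β₁ - a * δ₂ = t₀ * (β₀ - a * δ₁) := by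
  apply mul_left_cancel₀ hx1
  subst hα
  linear_combination  x * h'' / 2 - h / 2 - a * x * h' / 2 - hg + (-β₁ + a * δ₂ + a * t₀ * δ₁ - t₀ * β₀) * hx

/-- The moments `π^{-1/2} ∫ tⁿ e^{-t²} dt`, described by their recurrence. -/
def gaussMoment : ℕ → ℝ
  | 0 => 1
  | 1 => 0
  | n + 2 => (n + 1) / 2 * gaussMoment n

/-- The sequence $\kappa t^n$ is a particular solution for the source $b_n=-x\kappa t^n$, the
homogeneous equation is the Gaussian recurrence, and `h0` removes the odd homogeneous solution. -/
theorem hermite_recurrence {δ b : ℕ → ℂ} {x κ t : ℂ} (hx : x ≠ 0) (hb : ∀ n, b n = -x * κ * t ^ n)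
    (h0 : x * (2 * δ 1) = -2 * t * b 0)
    (h1 : ∀ n : ℕ, x * (2 * δ (n + 2) - (n + 1) * δ n) = (n + 1) * b n - 2 * t * b (n + 1)) (n : ℕ) :
    δ n = (δ 0 - κ) * gaussMoment n + κ * t ^ n := by
  induction n using Nat.strong_induction_on with
  | _ n ih =>
    match n with
    | 0 => simp [gaussMoment]
    | 1 =>
      simp only [gaussMoment]
      rw [hb] at h0
      apply mul_left_cancel₀ (mul_ne_zero two_ne_zero hx)
      push_cast
      linear_combination h0
    | n + 2 =>
      have h1 := h1 n
      rw [hb, hb, ih n (by omega)] at h1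
      simp only [gaussMoment]
      apply mul_left_cancel₀ (mul_ne_zero two_ne_zero hx)
      push_cast
      linear_combination h1

/-- The moment sequence of `γ W_a + ζ δ_{t₀} M(a, t₀)`, where `W_a` is normalized by `√π`. -/
def hermiteMomentSeq (a t₀ y γ ζ : ℝ) (n : ℕ) : Matrix (Fin 2) (Fin 2) ℂ :=
  cmat (γ * (gaussMoment n + a ^ 2 * gaussMoment (n + 2)) + ζ * t₀ ^ n * y ^ 2)
    (γ * (a * gaussMoment (n + 1)) + ζ * t₀ ^ n * y)
    (γ * (a * gaussMoment (n + 1)) + ζ * t₀ ^ n * y)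
    (γ * gaussMoment n + ζ * t₀ ^ n)

/-- The equations of orders two and one already determine the moments up to two real parameters; the
order-zero equation plays no part in this direction. -/
theorem exists_moment_eq_of_moment_equations {a t₀ x y : ℝ} (hxy : x + y = a * t₀)
    (hx : x ^ 2 = a * t₀ * x + 1) {S : ℕ → Matrix (Fin 2) (Fin 2) ℂ}
    (hS : ∀ n, (S n).IsHermitian) {G₁ G₂ : ℕ → Matrix (Fin 2) (Fin 2) ℂ}
    (hG₁ : ∀ N, G₁ N = cmat (-2 * a) (-2 * t₀ - 2 * a * x) (2 * t₀) 0 * S N +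
      cmat (2 * x) (2 * (2 + a ^ 2)) 0 (2 * (x - a * t₀)) * S (N + 1))
    (hG₂ : ∀ N, G₂ N = cmat (-x + a * t₀) (-1) (-1) (-x) * S N
        + cmat (-a) (-(a ^ 2 * t₀)) 0 a * S (N + 1) + cmat 0 (a ^ 2) 0 0 * S (N + 2))
    (h2 : ∀ N, (G₂ N).IsHermitian) (h1 : G₁ 0 + (G₁ 0)ᴴ = 0)
    (h1' : ∀ N : ℕ, G₁ (N + 1) + (G₁ (N + 1))ᴴ = (-2 * ((N : ℂ) + 1)) • G₂ N) :
    ∃ γ ζ : ℝ, ∀ n, S n = hermiteMomentSeq a t₀ y γ ζ n := by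
  have hx0 : (x : ℂ) ≠ 0 := by
    rw [Ne, Complex.ofReal_eq_zero]
    rintro rfl
    norm_num at hx
  have hx1 : (x : ℂ) ^ 2 + 1 ≠ 0 := by
    have : x ^ 2 + 1 ≠ 0 := by positivity
    exact_mod_cast this
  have hxc : (x : ℂ) ^ 2 = a * t₀ * x + 1 := by exact_mod_cast congrArg Complex.ofReal hx
  have hyc : (y : ℂ) = a * t₀ - x := by
    rw [← Complex.ofReal_mul, ← hxy]; push_cast; ring
  have e := hermite_entry_equations hS (fun N => hG₂ N ▸ h2 N)
  have f0 := hermite_first_order_equations (hS 0) (hS 1) (e 0).1 (e 1).1 (hG₁ 0) h1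
  have f := fun N => hermite_first_order_equations (hS (N + 1)) (hS (N + 2)) (e _).1 (e _).1
    (hG₁ (N + 1)) (h1' N)
  have g11 : ∀ N, G₂ N 1 1 = - S N 0 1 - x * S N 1 1 + a * S (N + 1) 1 1 := fun N => by
    simp [hG₂, cmat, Matrix.mul_apply, Fin.sum_univ_two]
    ring
  have g01 : ∀ N, G₂ N 0 1 = (a * t₀ - x) * S N 0 1 - S N 1 1 - a * S (N + 1) 0 1
      - a ^ 2 * t₀ * S (N + 1) 1 1 + a ^ 2 * S (N + 2) 1 1 := fun N => by
    simp [hG₂, cmat, Matrix.mul_apply, Fin.sum_univ_two]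
    ring
  simp only [Matrix.smul_apply, smul_eq_mul, g11, g01] at f
  simp only [Matrix.zero_apply] at f0
  have hb : ∀ n, S (n + 1) 0 1 - a * S (n + 2) 1 1 = t₀ * (S n 0 1 - a * S (n + 1) 1 1) := by
    rintro (_ | n)
    -- At the bottom level there is no preceding moment: the first-order right-hand side is zero.
    · refine hermite_shift 0 hxc hx1 (e 0).2 (g := 0) (g' := 0) ?_ ?_ ?_ (by ring)
      · linear_combination f0.1
      · linear_combination (f 0).1
      · linear_combination f0.2
    · refine hermite_shift (n + 1) hxc hx1 (e (n + 1)).2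
        (g := (n + 1) * (-S n 0 1 - x * S n 1 1 + a * S (n + 1) 1 1))
        (g' := (n + 1) * ((a * t₀ - x) * S n 0 1 - S n 1 1 - a * S (n + 1) 0 1
          - a ^ 2 * t₀ * S (n + 1) 1 1 + a ^ 2 * S (n + 2) 1 1))
        ((f n).1.trans (by ring)) ?_ ((f n).2.trans (by ring)) ?_
      · have := (f (n + 1)).1
        push_cast at this
        linear_combination this
      · linear_combination (n + 1) * (-S n 0 1 + a * S (n + 1) 1 1) * hxc
  have hreal : ∀ z : ℂ, star z = z → ((z.re : ℝ) : ℂ) = z := fun z hz => Complex.conj_eq_iff_re.1 hz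
  have hβ : ((S 0 0 1).re : ℂ) = S 0 0 1 := hreal _ (((hS 0).apply 1 0).trans (e 0).1)
  have hδ : ∀ n, ((S n 1 1).re : ℂ) = S n 1 1 := fun n => hreal _ ((hS n).apply 1 1)
  -- The Gaussian part contributes nothing to this defect and the atom contributes
  -- $\zeta(y-at_0)=-x\zeta$, which forces the value of `ζ`.
  obtain ⟨ζ, hζ⟩ : ∃ ζ : ℝ, S 0 0 1 - a * S 1 1 1 = -x * ζ := by
    refine ⟨-((S 0 0 1).re - a * (S 1 1 1).re) / x, ?_⟩
    push_cast
    rw [hβ, hδ]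
    field_simp
  have hb' : ∀ n, S n 0 1 - a * S (n + 1) 1 1 = -x * ζ * t₀ ^ n := fun n => by
    induction n with
    | zero => simpa using hζ
    | succ n ih => rw [hb, ih]; ring
  have key := hermite_recurrence (δ := fun n => S n 1 1)
    (b := fun n => S n 0 1 - a * S (n + 1) 1 1) hx0 hb' (by linear_combination f0.1 / 2)
    (fun n => by linear_combination (f n).1 / 2)
  have hβn : ∀ n, S n 0 1 = -x * ζ * t₀ ^ n + a * S (n + 1) 1 1 := fun n => by
    linear_combination hb' n
  obtain ⟨d, hd⟩ : ∃ d : ℝ, S 0 1 1 = d := ⟨_, (hδ 0).symm⟩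
  have key' : ∀ n, S n 1 1 = (d - ζ) * gaussMoment n + ζ * t₀ ^ n := fun n => by
    rw [← hd]
    exact key n
  -- The zeroth $(1,1)$ moment is $\gamma+\zeta$, since `gaussMoment 0 = 1`.
  refine ⟨d - ζ, ζ, fun n => ?_⟩
  ext i j
  fin_cases i <;> fin_cases j
  · simp [hermiteMomentSeq, cmat, (e n).2, hβn, key', hyc]
    linear_combination (-ζ * t₀ ^ n) * hxc
  · simp [hermiteMomentSeq, cmat, hβn, key', hyc]
    ring
  · simp [hermiteMomentSeq, cmat, (e n).1, hβn, key', hyc]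
    ring
  · simp [hermiteMomentSeq, cmat, key']

theorem hermiteMomentSeq_isHermitian (a t₀ y γ ζ : ℝ) (n : ℕ) :
    (hermiteMomentSeq a t₀ y γ ζ n).IsHermitian := by
  ext i j
  fin_cases i <;> fin_cases j <;> simp [hermiteMomentSeq, cmat]

/-! ### The candidate moments satisfy the equations -/

section Sufficiency

variable {a t₀ x y : ℝ} (hxy : x + y = a * t₀) (hx : x ^ 2 = a * t₀ * x + 1) (γ ζ : ℝ)

-- In this and the next three lemmas the Gaussian terms cancel identically by their recurrence. The
-- terms with `ζ` cancel modulo $x^2=at_0x+1$, which is why every nontrivial certificate is a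
-- multiple of `ζ` times `hxc`.
include hxy hx in
theorem hermite_moment_equation_two (N : ℕ) :
    (cmat (-x + a * t₀) (-1) (-1) (-x) * hermiteMomentSeq a t₀ y γ ζ N
      + cmat (-a) (-(a ^ 2 * t₀)) 0 a * hermiteMomentSeq a t₀ y γ ζ (N + 1)
      + cmat 0 (a ^ 2) 0 0 * hermiteMomentSeq a t₀ y γ ζ (N + 2)).IsHermitian := by
  obtain rfl : y = a * t₀ - x := by linear_combination hxy
  have hxc : (x : ℂ) ^ 2 = a * t₀ * x + 1 := by exact_mod_cast congrArg Complex.ofReal hx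
  ext i j
  fin_cases i <;> fin_cases j <;>
    simp [hermiteMomentSeq, cmat, Matrix.mul_apply, Fin.sum_univ_two, gaussMoment]
  · linear_combination (-ζ * t₀ ^ N) * hxc
  · linear_combination (ζ * t₀ ^ N) * hxc

include hxy hx in
theorem hermite_moment_equation_one_zero {G : Matrix (Fin 2) (Fin 2) ℂ}
    (hG : G = cmat (-2 * a) (-2 * t₀ - 2 * a * x) (2 * t₀) 0 * hermiteMomentSeq a t₀ y γ ζ 0 +
      cmat (2 * x) (2 * (2 + a ^ 2)) 0 (2 * (x - a * t₀)) * hermiteMomentSeq a t₀ y γ ζ 1) :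
    G + Gᴴ = 0 := by
  obtain rfl : y = a * t₀ - x := by linear_combination hxy
  have hxc : (x : ℂ) ^ 2 = a * t₀ * x + 1 := by exact_mod_cast congrArg Complex.ofReal hx
  subst hG
  ext i j
  fin_cases i <;> fin_cases j <;>
    simp [hermiteMomentSeq, cmat, Matrix.mul_apply, Fin.sum_univ_two, gaussMoment]
  · linear_combination (4 * ζ * t₀ * (x - a * t₀)) * hxc
  · linear_combination (-2 * ζ * t₀) * hxc
  · linear_combination (-2 * ζ * t₀) * hxc
  · ring

include hxy hx in
theorem hermite_moment_equation_one {G : Matrix (Fin 2) (Fin 2) ℂ} (N : ℕ)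
    (hG : G = cmat (-2 * a) (-2 * t₀ - 2 * a * x) (2 * t₀) 0 * hermiteMomentSeq a t₀ y γ ζ (N + 1) +
      cmat (2 * x) (2 * (2 + a ^ 2)) 0 (2 * (x - a * t₀)) * hermiteMomentSeq a t₀ y γ ζ (N + 2)) :
    G + Gᴴ = (-2 * ((N : ℂ) + 1)) •
      (cmat (-x + a * t₀) (-1) (-1) (-x) * hermiteMomentSeq a t₀ y γ ζ N
      + cmat (-a) (-(a ^ 2 * t₀)) 0 a * hermiteMomentSeq a t₀ y γ ζ (N + 1)
      + cmat 0 (a ^ 2) 0 0 * hermiteMomentSeq a t₀ y γ ζ (N + 2)) := by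
  obtain rfl : y = a * t₀ - x := by linear_combination hxy
  have hxc : (x : ℂ) ^ 2 = a * t₀ * x + 1 := by exact_mod_cast congrArg Complex.ofReal hx
  subst hG
  ext i j
  fin_cases i <;> fin_cases j <;>
    simp [hermiteMomentSeq, cmat, Matrix.mul_apply, Fin.sum_univ_two, gaussMoment]
  · linear_combination (ζ * t₀ ^ N * (x - a * t₀) * (4 * t₀ ^ 2 - 2 * (N + 1))) * hxc
  · linear_combination (ζ * t₀ ^ N * (2 * (N + 1) - 2 * t₀ ^ 2)) * hxc
  · linear_combination (-2 * ζ * t₀ ^ N * t₀ ^ 2) * hxc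
  · ring

include hxy hx in
theorem hermite_moment_equation_zero (ha : a ≠ 0) {G₀ G₁ G₂ : ℕ → Matrix (Fin 2) (Fin 2) ℂ}
    (hG₀ : ∀ N, G₀ N = cmat (x + 2 * t₀ / a) (2 * (2 + a ^ 2) / a ^ 2) (4 / a ^ 2)
      (-x - 2 * t₀ / a) * hermiteMomentSeq a t₀ y γ ζ N)
    (hG₁ : ∀ N, G₁ N = cmat (-2 * a) (-2 * t₀ - 2 * a * x) (2 * t₀) 0 * hermiteMomentSeq a t₀ y γ ζ N +
      cmat (2 * x) (2 * (2 + a ^ 2)) 0 (2 * (x - a * t₀)) * hermiteMomentSeq a t₀ y γ ζ (N + 1))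
    (hG₂ : ∀ N, G₂ N = cmat (-x + a * t₀) (-1) (-1) (-x) * hermiteMomentSeq a t₀ y γ ζ N
        + cmat (-a) (-(a ^ 2 * t₀)) 0 a * hermiteMomentSeq a t₀ y γ ζ (N + 1)
        + cmat 0 (a ^ 2) 0 0 * hermiteMomentSeq a t₀ y γ ζ (N + 2)) (N : ℕ) :
    G₀ N - (G₀ N)ᴴ = ((N : ℂ) * (N - 1)) • G₂ (N - 2) + (N : ℂ) • (G₁ (N - 1))ᴴ := by
  obtain rfl : y = a * t₀ - x := by linear_combination hxy
  have hxc : (x : ℂ) ^ 2 = a * t₀ * x + 1 := by exact_mod_cast congrArg Complex.ofReal hx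
  have hac : (a : ℂ) ≠ 0 := Complex.ofReal_ne_zero.2 ha
  rcases N with _ | _ | N
  · ext i j
    fin_cases i <;> fin_cases j <;>
      simp [hG₀, hermiteMomentSeq, cmat, Matrix.mul_apply, Fin.sum_univ_two, gaussMoment] <;>
      field_simp
    · ring
    · linear_combination (-ζ * (8 + 4 * a ^ 2)) * hxc
    · linear_combination (ζ * (8 + 4 * a ^ 2)) * hxc
    · ring
  · ext i j
    fin_cases i <;> fin_cases j <;>
      simp [hG₀, hG₁, hermiteMomentSeq, cmat, Matrix.mul_apply, Fin.sum_univ_two, gaussMoment] <;>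
      field_simp
    · linear_combination (-2 * t₀ * a ^ 2 * ζ * (x - a * t₀)) * hxc
    · linear_combination (-ζ * t₀ * (8 + 4 * a ^ 2)) * hxc
    · linear_combination (8 * ζ * t₀ * (1 + a ^ 2)) * hxc
    · ring
  · simp only [Nat.add_sub_cancel, show N + 2 - 1 = N + 1 from rfl, add_assoc, Nat.reduceAdd]
    ext i j
    fin_cases i <;> fin_cases j <;>
      simp [hG₀, hG₁, hG₂, hermiteMomentSeq, cmat, Matrix.mul_apply, Fin.sum_univ_two,
        gaussMoment] <;>
      field_simp
    · linear_combination ((N + 2) * t₀ ^ N * a ^ 2 * ζ * (x - a * t₀) * (4 * (N + 1) - 8 * t₀ ^ 2)) * hxc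
    · linear_combination (-ζ * t₀ ^ N *
        ((16 + 8 * a ^ 2) * t₀ ^ 2 + 4 * a ^ 2 * (N + 1) * (N + 2))) * hxc
    · linear_combination (ζ * t₀ ^ N * t₀ ^ 2 * (8 * N * a ^ 2 + 24 * a ^ 2 + 16)) * hxc
    · ring

end Sufficiency

/-! ### From moment sequences back to symmetry of the operator -/

section FormOfLowDegree

variable {n : Type*} [Fintype n] [DecidableEq n] {W : MatrixMeasure n} (hW : W.HasMoments)

include hW

theorem MatrixMeasure.form_quadratic (A B E : Matrix n n ℂ) (N : ℕ) :
    W.form (C A + C B * X + C E * X ^ 2) (X ^ N) =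
      A * W.moment N + B * W.moment (N + 1) + E * W.moment (N + 2) := by
  have h : ∀ (A : Matrix n n ℂ) (m : ℕ), W.form (C A * X ^ m) (X ^ N) = A * W.moment (m + N) :=
    fun A m => by rw [form_C_mul_left hW, form_X_pow]
  have h0 := h A 0
  have h1 := h B 1
  rw [pow_zero, mul_one, zero_add] at h0
  rw [pow_one] at h1
  rw [form_add_left hW, form_add_left hW, h0, h1, h, add_comm 1, add_comm 2]

theorem MatrixMeasure.form_linear (A B : Matrix n n ℂ) (N : ℕ) :
    W.form (C A + C B * X) (X ^ N) = A * W.moment N + B * W.moment (N + 1) := by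
  simpa using form_quadratic hW A B 0 N

theorem MatrixMeasure.form_C (A : Matrix n n ℂ) (N : ℕ) :
    W.form (C A) (X ^ N) = A * W.moment N := by
  simpa using form_quadratic hW A 0 0 N

end FormOfLowDegree

theorem hermiteXi_add (a t₀ s : ℝ) : hermiteXi a t₀ (-s) + hermiteXi a t₀ s = a * t₀ := by
  simp only [hermiteXi]; ring

/-- Together with `hermiteXi_add` this says that $\xi^\pm$ are the two roots of $\xi^2-at_0\xi-1$,
the only information about them used in the moment calculations. -/
theorem hermiteXi_sq (a t₀ : ℝ) {s : ℝ} (hs : s = 1 ∨ s = -1) :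
    hermiteXi a t₀ s ^ 2 = a * t₀ * hermiteXi a t₀ s + 1 := by
  have h : Real.sqrt (4 + a ^ 2 * t₀ ^ 2) ^ 2 = 4 + a ^ 2 * t₀ ^ 2 := Real.sq_sqrt (by positivity)
  rcases hs with rfl | rfl <;> simp only [hermiteXi] <;> linear_combination h / 4

theorem neg_eq_one_or_neg_one {s : ℝ} (hs : s = 1 ∨ s = -1) : -s = 1 ∨ -s = -1 := by
  rcases hs with rfl | rfl <;> simp

/-- The moments of every matrix of measures for which the operator is symmetric. -/
theorem exists_moment_eq_of_isSymmetric {a t₀ s : ℝ} (hs : s = 1 ∨ s = -1)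
    {W : MatrixMeasure (Fin 2)} (hW : W.HasMoments) (hH : ∀ m, (W.moment m)ᴴ = W.moment m)
    (h : (hermiteOp a t₀ s).IsSymmetric W) :
    ∃ γ ζ : ℝ, ∀ n, W.moment n = hermiteMomentSeq a t₀ (hermiteXi a t₀ s) γ ζ n := by
  obtain ⟨h2, h1, h1'⟩ := h.moment_equations hW hH
  exact exists_moment_eq_of_moment_equations (hermiteXi_add a t₀ s)
    (hermiteXi_sq a t₀ (neg_eq_one_or_neg_one hs)) hH
    (fun N => MatrixMeasure.form_linear hW _ _ N) (fun N => MatrixMeasure.form_quadratic hW _ _ _ N)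
    h2 h1 h1'

theorem isSymmetric_of_moment_eq {a t₀ s γ ζ : ℝ} (ha : a ≠ 0) (hs : s = 1 ∨ s = -1)
    {W : MatrixMeasure (Fin 2)} (hW : W.HasMoments)
    (h : ∀ n, W.moment n = hermiteMomentSeq a t₀ (hermiteXi a t₀ s) γ ζ n) :
    (hermiteOp a t₀ s).IsSymmetric W := by
  have hxy := hermiteXi_add a t₀ s
  have hx := hermiteXi_sq a t₀ (neg_eq_one_or_neg_one hs)
  have hG₂ : ∀ N, W.form (hermiteOp a t₀ s).F2 (X ^ N) = _ :=
    fun N => MatrixMeasure.form_quadratic hW _ _ _ N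
  have hG₁ : ∀ N, W.form (hermiteOp a t₀ s).F1 (X ^ N) = _ :=
    fun N => MatrixMeasure.form_linear hW _ _ N
  have hG₀ : ∀ N, W.form (hermiteOp a t₀ s).F0 (X ^ N) = _ :=
    fun N => MatrixMeasure.form_C hW _ N
  simp only [h] at hG₂ hG₁ hG₀
  refine SecondOrderOp.isSymmetric_of_moment_equations hW
    (fun m => by rw [h]; exact hermiteMomentSeq_isHermitian ..) (fun N => ?_) ?_ (fun N => ?_)
    (fun N => ?_)
  · rw [hG₂]
    exact hermite_moment_equation_two hxy hx γ ζ N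
  · exact hermite_moment_equation_one_zero hxy hx γ ζ (hG₁ 0)
  · rw [hG₂]
    exact hermite_moment_equation_one hxy hx γ ζ N (hG₁ (N + 1))
  · exact hermite_moment_equation_zero hxy hx γ ζ ha hG₀ hG₁ hG₂ N

/-! ### Gaussian moments and the moments of the weight with a mass -/

theorem integrable_pow_mul_gauss (n : ℕ) : Integrable fun t : ℝ => t ^ n * Real.exp (-t ^ 2) := by
  have := integrable_rpow_mul_exp_neg_mul_sq (b := 1) one_pos (s := n)
    (by have : (0 : ℝ) ≤ n := n.cast_nonneg; linarith)
  simpa using this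

/-- The derivative of $t^ne^{-t^2}$ has integral zero, which gives the recurrence. The case $n=0$
gives the vanishing first moment. -/
theorem integral_pow_mul_gauss (n : ℕ) :
    ∫ t : ℝ, t ^ n * Real.exp (-t ^ 2) = Real.sqrt Real.pi * gaussMoment n := by
  have hrec : ∀ n : ℕ, ∀ f : ℝ → ℝ, (∀ t, HasDerivAt (fun t : ℝ => t ^ n * Real.exp (-t ^ 2)) (f t) t) →
      Integrable f → ∫ t, f t = 0 := fun n f hf hi =>
    integral_eq_zero_of_hasDerivAt_of_integrable hf hi (integrable_pow_mul_gauss n)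
  have hder : ∀ (n : ℕ) (t : ℝ), HasDerivAt (fun t : ℝ => t ^ n * Real.exp (-t ^ 2))
      (n * (t ^ (n - 1) * Real.exp (-t ^ 2)) - 2 * (t ^ (n + 1) * Real.exp (-t ^ 2))) t := by
    intro n t
    have h1 := hasDerivAt_pow n t
    have h2 : HasDerivAt (fun t : ℝ => Real.exp (-t ^ 2)) (Real.exp (-t ^ 2) * (-(2 * t))) t := by
      simpa using ((hasDerivAt_pow 2 t).neg).exp
    convert! h1.mul h2 using 1
    ring
  have hkey : ∀ n : ℕ, n * ∫ t : ℝ, t ^ (n - 1) * Real.exp (-t ^ 2) =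
      2 * ∫ t : ℝ, t ^ (n + 1) * Real.exp (-t ^ 2) := by
    intro n
    have i1 := (integrable_pow_mul_gauss (n - 1)).const_mul (n : ℝ)
    have i2 := (integrable_pow_mul_gauss (n + 1)).const_mul 2
    have := hrec n _ (hder n) (i1.sub i2)
    rw [integral_sub i1 i2, integral_const_mul, integral_const_mul] at this
    linarith
  induction n using Nat.strong_induction_on with
  | _ n ih =>
    match n with
    | 0 => simpa [gaussMoment] using integral_gaussian 1
    | 1 =>
      have := hkey 0
      simp at this
      simpa [gaussMoment] using this
    | n + 2 =>
      have := hkey (n + 1)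
      rw [Nat.add_sub_cancel, ih n (by omega)] at this
      simp only [gaussMoment]
      push_cast at this
      linarith

theorem integrable_polynomial_mul_gauss (p : ℂ[X]) :
    Integrable fun t : ℝ => p.eval (t : ℂ) * (Real.exp (-t ^ 2) : ℝ) := by
  induction p using Polynomial.induction_on' with
  | add p q hp hq =>
    simp only [eval_add, add_mul]
    exact hp.add hq
  | monomial m c =>
    have := ((integrable_pow_mul_gauss m).ofReal (𝕜 := ℂ)).const_mul c
    simpa [mul_assoc] using this

/-- The entries of `e^{t²} W_a(t)`. -/
def hermiteFactor (a : ℝ) : Matrix (Fin 2) (Fin 2) ℝ[X] :=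
  !![1 + C (a ^ 2) * X ^ 2, C a * X; C a * X, 1]

/-- The entries of `W_a(t)` as real functions. -/
def hermiteEntry (a : ℝ) (i j : Fin 2) (t : ℝ) : ℝ :=
  (hermiteFactor a i j).eval t * Real.exp (-t ^ 2)

theorem hermiteDensity_apply (a t : ℝ) (i j : Fin 2) :
    hermiteDensity a t i j = hermiteEntry a i j t := by
  fin_cases i <;> fin_cases j <;>
    simp [hermiteDensity, hermiteEntry, hermiteFactor, cmat] <;> ring

theorem hermiteWeight_apply (a : ℝ) (i j : Fin 2) :
    hermiteWeight a i j =
      (volume : Measure ℝ).withDensityᵥ fun t => (hermiteEntry a i j t : ℂ) := by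
  simp only [hermiteWeight, Matrix.of_apply, hermiteDensity_apply]

theorem eval_map_ofReal (q : ℝ[X]) (t : ℝ) :
    (q.map (algebraMap ℝ ℂ)).eval (t : ℂ) = ((q.eval t : ℝ) : ℂ) := by
  rw [eval_map_algebraMap]
  exact aeval_algebraMap_apply_eq_algebraMap_eval t q

theorem integrable_polynomial_mul_hermiteEntry (a : ℝ) (i j : Fin 2) (p : ℂ[X]) :
    Integrable fun t : ℝ => p.eval (t : ℂ) * hermiteEntry a i j t := by
  refine (integrable_polynomial_mul_gauss
    (p * (hermiteFactor a i j).map (algebraMap ℝ ℂ))).congr (.of_forall fun t => ?_)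
  simp only [hermiteEntry, eval_mul, eval_map_ofReal]
  push_cast
  ring

theorem integrable_hermiteEntry (a : ℝ) (i j : Fin 2) : Integrable (hermiteEntry a i j) := by
  have := (integrable_polynomial_mul_hermiteEntry a i j 1).re
  simpa using this

theorem hermiteWeight_integral (a : ℝ) (i j : Fin 2) (p : ℂ[X]) :
    (hermiteWeight a i j).Integrable (fun t : ℝ => p.eval (t : ℂ)) ∧
      complexIntegral (hermiteWeight a i j) (fun t : ℝ => p.eval (t : ℂ)) =
        ∫ t : ℝ, p.eval (t : ℂ) * hermiteEntry a i j t := by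
  rw [hermiteWeight_apply]
  exact complexIntegral_withDensity (integrable_hermiteEntry a i j)
    (by fun_prop) (integrable_polynomial_mul_hermiteEntry a i j p)

theorem hermiteWeight_hasMoments (a : ℝ) : (hermiteWeight a).HasMoments := fun m i j => by
  simpa using (hermiteWeight_integral a i j (X ^ m)).1

theorem hermiteWeight_moment (a : ℝ) (n : ℕ) :
    -- With `ζ = 0` the location and the vector of the mass are irrelevant; zeros are placeholders.
    (hermiteWeight a).moment n = hermiteMomentSeq a 0 0 (Real.sqrt Real.pi) 0 n := by
  have h : ∀ i j, (hermiteWeight a).moment n i j =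
      ((∫ t : ℝ, t ^ n * hermiteEntry a i j t : ℝ) : ℂ) := fun i j => by
    have := (hermiteWeight_integral a i j (X ^ n)).2
    simp only [eval_pow, eval_X] at this
    rw [MatrixMeasure.moment, Matrix.of_apply, this, ← integral_complex_ofReal]
    simp
  have i0 := integral_pow_mul_gauss n
  have i1 := integral_pow_mul_gauss (n + 1)
  have i2 := integral_pow_mul_gauss (n + 2)
  have e1 : ∫ t : ℝ, t ^ n * (a * t * Real.exp (-t ^ 2)) =
      Real.sqrt Real.pi * (a * gaussMoment (n + 1)) := by
    rw [mul_left_comm, ← i1, ← integral_const_mul]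
    congr 1; ext t; ring
  have e2 : ∫ t : ℝ, t ^ n * ((1 + a ^ 2 * t ^ 2) * Real.exp (-t ^ 2)) =
      Real.sqrt Real.pi * (gaussMoment n + a ^ 2 * gaussMoment (n + 2)) := by
    rw [mul_add, mul_left_comm, ← i2, ← i0, ← integral_const_mul, ← integral_add
      (integrable_pow_mul_gauss n) ((integrable_pow_mul_gauss _).const_mul _)]
    congr 1; ext t; ring
  ext i j
  rw [h]
  fin_cases i <;> fin_cases j <;>
    simp [hermiteEntry, hermiteFactor, hermiteMomentSeq, cmat, e1, e2, i0]

theorem diracMass_integral (t₀ : ℝ) (M : Matrix (Fin 2) (Fin 2) ℂ) (i j : Fin 2) (p : ℂ[X]) :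
    (diracMass t₀ M i j).Integrable (fun t : ℝ => p.eval (t : ℂ)) ∧
      complexIntegral (diracMass t₀ M i j) (fun t : ℝ => p.eval (t : ℂ)) =
        p.eval (t₀ : ℂ) * M i j := by
  constructor
  · rw [VectorMeasure.Integrable, diracMass, Matrix.of_apply, VectorMeasure.variation_dirac]
    exact (integrable_dirac (by simp)).smul_measure (by simp)
  · rw [complexIntegral, diracMass, Matrix.of_apply, VectorMeasure.integral_dirac]
    simp

/-- The matrix of measures `γ W_a + ζ δ_{t₀} M(a, t₀)`. -/
abbrev hermiteMassWeight (a t₀ s γ ζ : ℝ) : MatrixMeasure (Fin 2) :=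
  γ • hermiteWeight a + ζ • diracMass t₀ (hermiteMass a t₀ s)

theorem hermiteMassWeight_integral (a t₀ s γ ζ : ℝ) (i j : Fin 2) (p : ℂ[X]) :
    (hermiteMassWeight a t₀ s γ ζ i j).Integrable (fun t : ℝ => p.eval (t : ℂ)) ∧
      complexIntegral (hermiteMassWeight a t₀ s γ ζ i j) (fun t : ℝ => p.eval (t : ℂ)) =
        γ * (∫ t : ℝ, p.eval (t : ℂ) * hermiteEntry a i j t) +
          ζ * (p.eval (t₀ : ℂ) * hermiteMass a t₀ s i j) := by
  obtain ⟨i1, e1⟩ := hermiteWeight_integral a i j p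
  obtain ⟨i2, e2⟩ := diracMass_integral t₀ (hermiteMass a t₀ s) i j p
  have j1 := i1.smul_vectorMeasure γ
  have j2 := i2.smul_vectorMeasure ζ
  refine ⟨j1.add_vectorMeasure j2, ?_⟩
  unfold complexIntegral at e1 e2 ⊢
  have e : hermiteMassWeight a t₀ s γ ζ i j =
      γ • hermiteWeight a i j + ζ • diracMass t₀ (hermiteMass a t₀ s) i j := rfl
  rw [e, VectorMeasure.integral_add_vectorMeasure j1 j2, VectorMeasure.integral_smul_vectorMeasure,
    VectorMeasure.integral_smul_vectorMeasure, e1, e2]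
  simp

theorem hermiteMassWeight_hasMoments (a t₀ s γ ζ : ℝ) :
    (hermiteMassWeight a t₀ s γ ζ).HasMoments := fun m i j => by
  simpa using (hermiteMassWeight_integral a t₀ s γ ζ i j (X ^ m)).1

theorem hermiteMassWeight_moment (a t₀ s γ ζ : ℝ) (n : ℕ) :
    (hermiteMassWeight a t₀ s γ ζ).moment n =
      hermiteMomentSeq a t₀ (hermiteXi a t₀ s) (γ * Real.sqrt Real.pi) ζ n := by
  have h : ∀ i j, (hermiteMassWeight a t₀ s γ ζ).moment n i j =
      γ * (hermiteWeight a).moment n i j + ζ * (t₀ ^ n * hermiteMass a t₀ s i j) := fun i j => by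
    have h1 := (hermiteMassWeight_integral a t₀ s γ ζ i j (X ^ n)).2
    have h2 := (hermiteWeight_integral a i j (X ^ n)).2
    rw [← h2] at h1
    simpa [MatrixMeasure.moment] using h1
  ext i j
  rw [h, hermiteWeight_moment]
  fin_cases i <;> fin_cases j <;> simp [hermiteMomentSeq, hermiteMass, cmat] <;> ring

theorem hermiteMassWeight_isSymmetric {a t₀ s : ℝ} (ha : a ≠ 0) (hs : s = 1 ∨ s = -1) (γ ζ : ℝ) :
    (hermiteOp a t₀ s).IsSymmetric (hermiteMassWeight a t₀ s γ ζ) :=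
  isSymmetric_of_moment_eq ha hs (hermiteMassWeight_hasMoments a t₀ s γ ζ)
    (hermiteMassWeight_moment a t₀ s γ ζ)

/-! ### Scalar quadratic measures and positivity -/

/-- The complex measure `x^* W x`. -/
def MatrixMeasure.quadMeasure (W : MatrixMeasure (Fin 2)) (x : Fin 2 → ℂ) : ComplexMeasure ℝ :=
  ∑ i, ∑ j, (star (x i) * x j) • W i j

theorem MatrixMeasure.quadMeasure_apply (W : MatrixMeasure (Fin 2)) (x : Fin 2 → ℂ) (s : Set ℝ) :
    W.quadMeasure x s = star x ⬝ᵥ (W.onSet s *ᵥ x) := by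
  simp [quadMeasure, onSet, dotProduct, Matrix.mulVec]
  ring

theorem MatrixMeasure.quadMeasure_moment {W : MatrixMeasure (Fin 2)} (hW : W.HasMoments)
    (x : Fin 2 → ℂ) (m : ℕ) :
    (W.quadMeasure x).Integrable (fun t : ℝ => (t : ℂ) ^ m) ∧
      complexIntegral (W.quadMeasure x) (fun t : ℝ => (t : ℂ) ^ m) =
        star x ⬝ᵥ (W.moment m *ᵥ x) := by
  have hi : ∀ i j, ((star (x i) * x j) • W i j).Integrable (fun t : ℝ => (t : ℂ) ^ m) := fun i j =>
    integrable_smul_complexMeasure (hW m i j) _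
  have he : ∀ i j, complexIntegral ((star (x i) * x j) • W i j) (fun t : ℝ => (t : ℂ) ^ m) =
      (star (x i) * x j) * W.moment m i j := fun i j => complexIntegral_smul_measure _ (hW m i j)
  have h0 := (hi 0 0).add_vectorMeasure (hi 0 1)
  have h1 := (hi 1 0).add_vectorMeasure (hi 1 1)
  simp only [quadMeasure, Fin.sum_univ_two, dotProduct, Matrix.mulVec]
  refine ⟨h0.add_vectorMeasure h1, ?_⟩
  unfold complexIntegral at he ⊢
  rw [VectorMeasure.integral_add_vectorMeasure h0 h1,
    VectorMeasure.integral_add_vectorMeasure (hi _ _) (hi _ _),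
    VectorMeasure.integral_add_vectorMeasure (hi _ _) (hi _ _), he, he, he, he]
  simp only [Pi.star_apply]
  ring

/-- The density of `x^* W_a x`. -/
def hermiteQuad (a : ℝ) (x : Fin 2 → ℂ) (t : ℝ) : ℝ :=
  (‖x 0‖ ^ 2 + ‖a * t * x 0 + x 1‖ ^ 2) * Real.exp (-t ^ 2)

theorem hermiteQuad_nonneg (a : ℝ) (x : Fin 2 → ℂ) (t : ℝ) : 0 ≤ hermiteQuad a x t := by
  unfold hermiteQuad
  positivity

theorem ofReal_hermiteQuad (a : ℝ) (x : Fin 2 → ℂ) (t : ℝ) :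
    (hermiteQuad a x t : ℂ) = ∑ i, ∑ j, (star (x i) * x j) * hermiteEntry a i j t := by
  have h : ∀ z : ℂ, ((‖z‖ : ℂ)) ^ 2 = star z * z := fun z => (Complex.conj_mul' z).symm
  rw [hermiteQuad]
  push_cast
  rw [h, h]
  simp [hermiteEntry, hermiteFactor, Fin.sum_univ_two]
  ring

theorem integrable_hermiteQuad (a : ℝ) (x : Fin 2 → ℂ) : Integrable (hermiteQuad a x) := by
  have h : Integrable fun t => (hermiteQuad a x t : ℂ) := by
    simp only [ofReal_hermiteQuad]
    exact integrable_finsetSum _ fun i _ => integrable_finsetSum _ fun j _ =>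
      (integrable_hermiteEntry a i j).ofReal.const_mul _
  simpa using h.re

/-- The positive measure `x^* W_a x`. -/
def hermiteQuadMeasure (a : ℝ) (x : Fin 2 → ℂ) : Measure ℝ :=
  volume.withDensity fun t => ENNReal.ofReal (hermiteQuad a x t)

instance (a : ℝ) (x : Fin 2 → ℂ) : IsFiniteMeasure (hermiteQuadMeasure a x) :=
  isFiniteMeasure_withDensity_ofReal (integrable_hermiteQuad a x).2

theorem hermiteWeight_quadMeasure (a : ℝ) (x : Fin 2 → ℂ) {s : Set ℝ} (hs : MeasurableSet s) :
    (hermiteWeight a).quadMeasure x s = ((hermiteQuadMeasure a x).real s : ℂ) := by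
  have e : (hermiteQuadMeasure a x).real s = ∫ t in s, hermiteQuad a x t := by
    rw [hermiteQuadMeasure, measureReal_def, withDensity_apply _ hs,
      ← ofReal_integral_eq_lintegral_ofReal (integrable_hermiteQuad a x).integrableOn
        (.of_forall (hermiteQuad_nonneg a x)),
      ENNReal.toReal_ofReal (integral_nonneg (hermiteQuad_nonneg a x))]
  rw [e, ← integral_complex_ofReal]
  simp only [ofReal_hermiteQuad, MatrixMeasure.quadMeasure, FunLike.coe_sum,
    Finset.sum_apply, _root_.smul_apply, hermiteWeight_apply]
  have hi : ∀ i j, Integrable (fun t => star (x i) * x j * (hermiteEntry a i j t : ℂ))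
      (volume.restrict s) := fun i j =>
    ((integrable_hermiteEntry a i j).ofReal.const_mul _).integrableOn
  rw [integral_finsetSum _ fun i _ => integrable_finsetSum _ fun j _ => hi i j]
  refine Finset.sum_congr rfl fun i _ => ?_
  rw [integral_finsetSum _ fun j _ => hi i j]
  refine Finset.sum_congr rfl fun j _ => ?_
  rw [withDensityᵥ_apply (integrable_hermiteEntry a i j).ofReal hs, smul_eq_mul,
    ← integral_const_mul]

/-- The positive measure `x^* δ_{t₀} M(a, t₀) x`, where `M(a, t₀) = (y, 1)^T (y, 1)`. -/
def diracQuadMeasure (t₀ y : ℝ) (x : Fin 2 → ℂ) : Measure ℝ :=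
  ENNReal.ofReal (‖y * x 0 + x 1‖ ^ 2) • Measure.dirac t₀

instance (t₀ y : ℝ) (x : Fin 2 → ℂ) : IsFiniteMeasure (diracQuadMeasure t₀ y x) :=
  Measure.smul_finite _ ENNReal.ofReal_ne_top

theorem dotProduct_hermiteMass (a t₀ s : ℝ) (x : Fin 2 → ℂ) :
    star x ⬝ᵥ (hermiteMass a t₀ s *ᵥ x) = ((‖hermiteXi a t₀ s * x 0 + x 1‖ ^ 2 : ℝ) : ℂ) := by
  push_cast
  rw [← Complex.conj_mul']
  simp [hermiteMass, cmat, dotProduct, Matrix.mulVec, Fin.sum_univ_two]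
  ring

theorem diracMass_quadMeasure (a t₀ s : ℝ) (x : Fin 2 → ℂ) {S : Set ℝ} (hS : MeasurableSet S) :
    (diracMass t₀ (hermiteMass a t₀ s)).quadMeasure x S =
      ((diracQuadMeasure t₀ (hermiteXi a t₀ s) x).real S : ℂ) := by
  rw [MatrixMeasure.quadMeasure_apply, diracQuadMeasure, measureReal_ennreal_smul_apply,
    ENNReal.toReal_ofReal (by positivity), measureReal_def, Measure.dirac_apply' _ hS]
  by_cases h : t₀ ∈ S
  · have : (diracMass t₀ (hermiteMass a t₀ s)).onSet S = hermiteMass a t₀ s := by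
      ext i j
      simp [MatrixMeasure.onSet, diracMass, hS, h]
    rw [this, dotProduct_hermiteMass]
    simp [h]
  · have : (diracMass t₀ (hermiteMass a t₀ s)).onSet S = 0 := by
      ext i j
      simp [MatrixMeasure.onSet, diracMass, h]
    rw [this]
    simp [h]

theorem quadMeasure_add (W W' : MatrixMeasure (Fin 2)) (x : Fin 2 → ℂ) :
    (W + W').quadMeasure x = W.quadMeasure x + W'.quadMeasure x := by
  simp [MatrixMeasure.quadMeasure, Finset.sum_add_distrib]

theorem quadMeasure_smul (c : ℝ) (W : MatrixMeasure (Fin 2)) (x : Fin 2 → ℂ) :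
    (c • W).quadMeasure x = c • W.quadMeasure x := by
  simp only [MatrixMeasure.quadMeasure, Finset.smul_sum, Matrix.smul_apply]
  simp only [smul_comm c]

theorem hermiteMassWeight_quadMeasure (a t₀ s γ ζ : ℝ) (x : Fin 2 → ℂ) {S : Set ℝ}
    (hS : MeasurableSet S) :
    (hermiteMassWeight a t₀ s γ ζ).quadMeasure x S =
      ((γ * (hermiteQuadMeasure a x).real S +
        ζ * (diracQuadMeasure t₀ (hermiteXi a t₀ s) x).real S : ℝ) : ℂ) := by
  rw [quadMeasure_add, quadMeasure_smul, quadMeasure_smul, _root_.add_apply,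
    _root_.smul_apply, _root_.smul_apply, hermiteWeight_quadMeasure a x hS,
    diracMass_quadMeasure a t₀ s x hS]
  simp

theorem hermiteMass_isHermitian (a t₀ s : ℝ) : (hermiteMass a t₀ s).IsHermitian := by
  ext i j
  fin_cases i <;> fin_cases j <;> simp [hermiteMass, cmat]

theorem hermiteMass_posSemidef (a t₀ s : ℝ) : (hermiteMass a t₀ s).PosSemidef := by
  refine .of_dotProduct_mulVec_nonneg (hermiteMass_isHermitian a t₀ s) fun x => ?_
  rw [dotProduct_hermiteMass]
  exact Complex.zero_le_real.2 (sq_nonneg _)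

theorem hermiteEntry_symm (a : ℝ) (i j : Fin 2) : hermiteEntry a i j = hermiteEntry a j i := by
  fin_cases i <;> fin_cases j <;> rfl

theorem hermiteMassWeight_posSemidef (a t₀ s : ℝ) {γ ζ : ℝ} (hγ : 0 ≤ γ) (hζ : 0 ≤ ζ) {S : Set ℝ}
    (hS : MeasurableSet S) : ((hermiteMassWeight a t₀ s γ ζ).onSet S).PosSemidef := by
  refine .of_dotProduct_mulVec_nonneg ?_ fun x => ?_
  · have h : ∀ i j, (hermiteMassWeight a t₀ s γ ζ).onSet S i j =
        γ * ((∫ t in S, hermiteEntry a i j t : ℝ) : ℂ) +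
          ζ * (diracMass t₀ (hermiteMass a t₀ s)).onSet S i j := fun i j => by
      simp only [MatrixMeasure.onSet, Matrix.of_apply, Matrix.add_apply, Matrix.smul_apply,
        _root_.add_apply, _root_.smul_apply, hermiteWeight_apply,
        withDensityᵥ_ofReal_apply (integrable_hermiteEntry a i j) hS]
      simp
    -- The scalar is an entry of the point mass with identity matrix, used as the indicator of `t₀ ∈
    -- S`.
    have h' : (diracMass t₀ (hermiteMass a t₀ s)).onSet S =
        (diracMass t₀ 1 (0 : Fin 2) 0 S) • hermiteMass a t₀ s := by
      ext i j
      by_cases ht : t₀ ∈ S <;> simp [MatrixMeasure.onSet, diracMass, ht, hS]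
    have h1 : star (diracMass t₀ 1 (0 : Fin 2) 0 S) = diracMass t₀ 1 (0 : Fin 2) 0 S := by
      by_cases ht : t₀ ∈ S <;> simp [diracMass, ht, hS]
    ext i j
    have h2 := (hermiteMass_isHermitian a t₀ s).apply i j
    rw [Matrix.conjTranspose_apply, h, h, h', Matrix.smul_apply, Matrix.smul_apply,
      hermiteEntry_symm a j i]
    simp only [star_add, star_mul', smul_eq_mul, h1, h2]
    simp
  · rw [← MatrixMeasure.quadMeasure_apply, hermiteMassWeight_quadMeasure a t₀ s γ ζ x hS]
    exact_mod_cast add_nonneg (mul_nonneg hγ measureReal_nonneg) (mul_nonneg hζ measureReal_nonneg)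

/-! ### Definiteness of the form and nonsingularity -/

theorem polynomial_eq_zero_of_eval_ofReal {p : ℂ[X]} (h : ∀ t : ℝ, p.eval (t : ℂ) = 0) : p = 0 :=
  eq_zero_of_infinite_isRoot p ((Set.infinite_range_of_injective Complex.ofReal_injective).mono
    (by rintro _ ⟨t, rfl⟩; exact h t))

/-- Each diagonal entry involves a single row of `Q`. Conjugating that row turns $qWq^*$ into the
quadratic expression $v^*Wv$, so the entry is visibly a sum of nonnegative terms. -/
theorem hermiteMassWeight_form_diag (a t₀ s γ ζ : ℝ) (Q : MatPoly (Fin 2)) (i : Fin 2) :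
    (hermiteMassWeight a t₀ s γ ζ).form Q Q i i =
      ((γ * (∫ t : ℝ, hermiteQuad a (fun k => star ((Q.entry i k).eval (t : ℂ))) t) +
        ζ * ‖hermiteXi a t₀ s * star ((Q.entry i 0).eval (t₀ : ℂ)) +
          star ((Q.entry i 1).eval (t₀ : ℂ))‖ ^ 2 : ℝ) : ℂ) := by
  have hi := fun k l =>
    integrable_polynomial_mul_hermiteEntry a k l (Q.entry i k * conjPoly (Q.entry i l))
  have h1 := dotProduct_hermiteMass a t₀ s fun k => star ((Q.entry i k).eval (t₀ : ℂ))
  rw [MatrixMeasure.form_apply]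
  simp only [(hermiteMassWeight_integral a t₀ s γ ζ _ _ _).2, Finset.sum_add_distrib,
    ← Finset.mul_sum]
  rw [Complex.ofReal_add, Complex.ofReal_mul, Complex.ofReal_mul, ← h1, ← integral_complex_ofReal]
  simp only [ofReal_hermiteQuad]
  congr 2
  · simp only [← integral_finsetSum _ fun l _ => hi _ l]
    rw [← integral_finsetSum _ fun k _ => integrable_finsetSum _ fun l _ => hi k l]
    simp [← star_eval_ofReal]
  · simp only [dotProduct, Matrix.mulVec, Pi.star_apply, star_star, Finset.mul_sum, eval_mul,
      ← star_eval_ofReal]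
    refine Finset.sum_congr rfl fun k _ => Finset.sum_congr rfl fun l _ => by ring

theorem continuous_hermiteQuad_eval (a : ℝ) (p : Fin 2 → ℂ[X]) :
    Continuous fun t : ℝ => hermiteQuad a (fun k => star ((p k).eval (t : ℂ))) t := by
  unfold hermiteQuad
  fun_prop

theorem integrable_hermiteQuad_eval (a : ℝ) (p : Fin 2 → ℂ[X]) :
    Integrable fun t : ℝ => hermiteQuad a (fun k => star ((p k).eval (t : ℂ))) t := by
  have h : Integrable fun t : ℝ =>
      (hermiteQuad a (fun k => star ((p k).eval (t : ℂ))) t : ℂ) := by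
    simp only [ofReal_hermiteQuad]
    refine integrable_finsetSum _ fun i _ => integrable_finsetSum _ fun j _ => ?_
    refine (integrable_polynomial_mul_hermiteEntry a i j (p i * conjPoly (p j))).congr
      (.of_forall fun t => ?_)
    simp [← star_eval_ofReal]
  simpa using h.re

theorem hermiteQuad_eq_zero {a : ℝ} {x : Fin 2 → ℂ} {t : ℝ} (h : hermiteQuad a x t = 0) :
    x = 0 := by
  have h' : ‖x 0‖ ^ 2 + ‖a * t * x 0 + x 1‖ ^ 2 = 0 :=
    (mul_eq_zero.1 h).resolve_right (Real.exp_ne_zero _)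
  rw [add_eq_zero_iff_of_nonneg (by positivity) (by positivity)] at h'
  have h0 : x 0 = 0 := by simpa using h'.1
  have h1 : x 1 = 0 := by simpa [h0] using h'.2
  ext k
  fin_cases k <;> simp [h0, h1]

/-- The form of `γ W_a + ζ δ_{t₀} M(a, t₀)` is definite. -/
theorem hermiteMassWeight_form_self_eq_zero {a t₀ s γ ζ : ℝ} (hγ : 0 < γ) (hζ : 0 ≤ ζ)
    {Q : MatPoly (Fin 2)} (h : (hermiteMassWeight a t₀ s γ ζ).form Q Q = 0) : Q = 0 := by
  have key : ∀ i k, Q.entry i k = 0 := fun i => by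
    have h1 := hermiteMassWeight_form_diag a t₀ s γ ζ Q i
    rw [h, Matrix.zero_apply, eq_comm, Complex.ofReal_eq_zero] at h1
    have h0 : ∀ t : ℝ, 0 ≤ hermiteQuad a (fun k => star ((Q.entry i k).eval (t : ℂ))) t :=
      fun t => hermiteQuad_nonneg _ _ _
    have h2 := integral_nonneg (μ := volume) (f := fun t : ℝ => hermiteQuad a _ t) h0
    rw [add_eq_zero_iff_of_nonneg (by positivity) (by positivity)] at h1
    have h3 := (mul_eq_zero.1 h1.1).resolve_left hγ.ne'
    rw [integral_eq_zero_iff_of_nonneg h0 (integrable_hermiteQuad_eval a (Q.entry i))] at h3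
    have h4 := (Continuous.ae_eq_iff_eq volume (continuous_hermiteQuad_eval a (Q.entry i))
      continuous_const).1 h3
    intro k
    refine polynomial_eq_zero_of_eval_ofReal fun t => ?_
    have h5 := congrFun (hermiteQuad_eq_zero (congrFun h4 t)) k
    simpa using h5
  refine MatPoly.ext_entry fun i k => ?_
  rw [key]
  simp [MatPoly.entry]

theorem MatrixMeasure.isUnit_form_self {W : MatrixMeasure (Fin 2)} (hW : W.HasMoments)
    (h : ∀ Q, W.form Q Q = 0 → Q = 0) {P : MatPoly (Fin 2)} (hP : IsUnit P.leadingCoeff) :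
    IsUnit (W.form P P) := by
  by_contra hF
  rw [Matrix.isUnit_iff_isUnit_det, isUnit_iff_ne_zero, not_not] at hF
  obtain ⟨v, hv, hvF⟩ := Matrix.exists_vecMul_eq_zero_iff.2 hF
  -- Repeating a left null vector in every row makes it a matrix coefficient. Its product with `P`
  -- is isotropic, hence zero, and the invertible leading coefficient forces `v = 0`.
  have hA : Matrix.of (fun _ : Fin 2 => v) * W.form P P = 0 := by
    ext i j
    exact congrFun hvF j
  have hQ := h (C (Matrix.of fun _ => v) * P) (by
    rw [form_C_mul_left hW, form_C_mul_right hW, ← mul_assoc, hA, zero_mul])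
  have hc := congrArg (fun Q => coeff Q P.natDegree) hQ
  simp only [coeff_C_mul, coeff_zero] at hc
  exact hv (congrFun (hP.mul_left_eq_zero.1 hc) 0)

theorem hermiteMassWeight_isWeightMatrix (a t₀ s : ℝ) {γ ζ : ℝ} (hγ : 0 < γ) (hζ : 0 ≤ ζ) :
    IsWeightMatrix (hermiteMassWeight a t₀ s γ ζ) where
  posSemidef _ hS := hermiteMassWeight_posSemidef a t₀ s hγ.le hζ hS
  moments := hermiteMassWeight_hasMoments a t₀ s γ ζ
  nonsingular _ hP := MatrixMeasure.isUnit_form_self (hermiteMassWeight_hasMoments a t₀ s γ ζ)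
    (fun _ => hermiteMassWeight_form_self_eq_zero hγ hζ) hP

/-! ### Moment determinacy -/

theorem integrable_pow_of_integrable_exp {μ : Measure ℝ}
    (h : ∀ c : ℝ, Integrable (fun t : ℝ => Real.exp |c * t|) μ) (n : ℕ) :
    Integrable (fun t : ℝ => t ^ n) μ := by
  refine ((h 1).const_mul (n.factorial : ℝ)).mono' (by fun_prop) (.of_forall fun t => ?_)
  have := Real.pow_div_factorial_le_exp |t| (abs_nonneg t) n
  rw [div_le_iff₀ (by positivity)] at this
  simpa [mul_comm] using this

/-- The series of `cosh` has only even, nonnegative terms, so it can be integrated termwise without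
assuming exponential integrability. -/
theorem lintegral_cosh {μ : Measure ℝ} (h : ∀ n : ℕ, Integrable (fun t : ℝ => t ^ n) μ) (c : ℝ) :
    ∫⁻ t, ENNReal.ofReal (Real.cosh (c * t)) ∂μ =
      ∑' n : ℕ, ENNReal.ofReal (c ^ (2 * n) / (2 * n).factorial * ∫ t, t ^ (2 * n) ∂μ) := by
  have h0 : ∀ (n : ℕ) (t : ℝ), 0 ≤ (c * t) ^ (2 * n) / (2 * n).factorial := fun n t =>
    div_nonneg ((even_two_mul n).pow_nonneg _) (by positivity)
  have h1 : ∀ t : ℝ, ENNReal.ofReal (Real.cosh (c * t)) =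
      ∑' n : ℕ, ENNReal.ofReal ((c * t) ^ (2 * n) / (2 * n).factorial) := fun t => by
    rw [← (Real.hasSum_cosh (c * t)).tsum_eq,
      ENNReal.ofReal_tsum_of_nonneg (fun n => h0 n t) (Real.hasSum_cosh (c * t)).summable]
  simp only [h1]
  rw [lintegral_tsum fun n => by fun_prop]
  congr 1
  ext n
  have e : ∀ t : ℝ, (c * t) ^ (2 * n) / (2 * n).factorial =
      c ^ (2 * n) / (2 * n).factorial * t ^ (2 * n) := fun t => by ring
  rw [← ofReal_integral_eq_lintegral_ofReal _ (.of_forall (h0 n))]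
  · simp only [e, integral_const_mul]
  · simp only [e]
    exact (h (2 * n)).const_mul _

/-- Equality of even moments makes the integrals of `cosh (c * t)` equal, and `exp |c * t|` is at
most twice `cosh (c * t)`. Exponential integrability thus passes from `ν` to `μ`. -/
theorem integrable_exp_abs_of_moments_eq {μ ν : Measure ℝ}
    (hμ : ∀ n : ℕ, Integrable (fun t : ℝ => t ^ n) μ)
    (h : ∀ n : ℕ, ∫ t, t ^ n ∂μ = ∫ t, t ^ n ∂ν)
    (hν : ∀ c : ℝ, Integrable (fun t : ℝ => Real.exp |c * t|) ν) (c : ℝ) :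
    Integrable (fun t : ℝ => Real.exp |c * t|) μ := by
  have hc : Integrable (fun t : ℝ => Real.cosh (c * t)) ν := by
    refine (hν c).mono' (by fun_prop) (.of_forall fun t => ?_)
    rw [Real.norm_of_nonneg (Real.cosh_pos _).le, ← Real.cosh_abs, Real.cosh_eq]
    have := Real.exp_le_exp.2 (show -|c * t| ≤ |c * t| by linarith [abs_nonneg (c * t)])
    linarith
  have hc' : Integrable (fun t : ℝ => Real.cosh (c * t)) μ := by
    refine ⟨by fun_prop, ?_⟩
    rw [hasFiniteIntegral_iff_ofReal (.of_forall fun t => (Real.cosh_pos _).le), lintegral_cosh hμ]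
    simp only [h]
    rw [← lintegral_cosh (integrable_pow_of_integrable_exp hν)]
    exact (hasFiniteIntegral_iff_ofReal (.of_forall fun t => (Real.cosh_pos _).le)).1 hc.2
  refine (hc'.const_mul 2).mono' (by fun_prop) (.of_forall fun t => ?_)
  rw [Real.norm_of_nonneg (Real.exp_pos _).le, ← Real.cosh_abs, Real.cosh_eq]
  linarith [Real.exp_pos (-|c * t|)]

/-- The partial sums of the exponential series are dominated by `exp |c * t|`, so the characteristic
function is everywhere the sum of its moment series. -/
theorem hasSum_charFun {μ : Measure ℝ}
    (h : ∀ c : ℝ, Integrable (fun t : ℝ => Real.exp |c * t|) μ) (c : ℝ) :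
    HasSum (fun n : ℕ => (c * Complex.I) ^ n / n.factorial * ((∫ t, t ^ n ∂μ : ℝ) : ℂ))
      (charFun μ c) := by
  have hs : ∀ t : ℝ, HasSum (fun n : ℕ => |c * t| ^ n / n.factorial) (Real.exp |c * t|) :=
    fun t => by
      rw [Real.exp_eq_exp_ℝ]
      exact NormedSpace.expSeries_div_hasSum_exp |c * t|
  have key := hasSum_integral_of_dominated_convergence (μ := μ)
    (F := fun (n : ℕ) (t : ℝ) => (c * t * Complex.I) ^ n / n.factorial)
    (f := fun t : ℝ => Complex.exp (c * t * Complex.I))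
    (fun n t => |c * t| ^ n / n.factorial) (fun n => by fun_prop)
    (fun n => .of_forall fun t => by simp) (.of_forall fun t => (hs t).summable)
    (by simpa only [(hs _).tsum_eq] using h c)
    (.of_forall fun t => by
      rw [Complex.exp_eq_exp_ℂ]
      exact NormedSpace.expSeries_div_hasSum_exp _)
  rw [charFun_apply_real]
  convert! key using 2 with n
  rw [← integral_complex_ofReal, ← integral_const_mul]
  congr 1
  ext t
  push_cast
  ring

/-- A measure with exponential moments is determined by its power moments. -/
theorem measure_ext_of_moments {μ ν : Measure ℝ} [IsFiniteMeasure μ] [IsFiniteMeasure ν]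
    (hμ : ∀ n : ℕ, Integrable (fun t : ℝ => t ^ n) μ)
    (h : ∀ n : ℕ, ∫ t, t ^ n ∂μ = ∫ t, t ^ n ∂ν)
    (hν : ∀ c : ℝ, Integrable (fun t : ℝ => Real.exp |c * t|) ν) : μ = ν := by
  refine Measure.ext_of_charFun (funext fun c => ?_)
  have h1 := hasSum_charFun (integrable_exp_abs_of_moments_eq hμ h hν) c
  simp only [h] at h1
  exact h1.unique (hasSum_charFun hν c)

theorem measureReal_eq_of_moments {μ α β : Measure ℝ} [IsFiniteMeasure μ] [IsFiniteMeasure α]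
    [IsFiniteMeasure β] (hμ : ∀ n : ℕ, Integrable (fun t : ℝ => t ^ n) μ) {γ ζ : ℝ}
    (h : ∀ n : ℕ, ∫ t, t ^ n ∂μ = γ * ∫ t, t ^ n ∂α + ζ * ∫ t, t ^ n ∂β)
    (hα : ∀ c : ℝ, Integrable (fun t : ℝ => Real.exp |c * t|) α)
    (hβ : ∀ c : ℝ, Integrable (fun t : ℝ => Real.exp |c * t|) β) (s : Set ℝ) :
    μ.real s = γ * α.real s + ζ * β.real s := by
  have hαp := integrable_pow_of_integrable_exp hα
  have hβp := integrable_pow_of_integrable_exp hβ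
  -- The signs of `γ` and `ζ` are not yet known. Moving the negative parts to the left produces two
  -- genuine positive measures to compare.
  have hext : μ + (-γ).toNNReal • α + (-ζ).toNNReal • β = γ.toNNReal • α + ζ.toNNReal • β := by
    refine measure_ext_of_moments (fun n => ?_) (fun n => ?_) (fun c => ?_)
    · exact ((hμ n).add_measure ((hαp n).smul_measure_nnreal)).add_measure
        ((hβp n).smul_measure_nnreal)
    · rw [integral_add_measure ((hμ n).add_measure ((hαp n).smul_measure_nnreal))
        ((hβp n).smul_measure_nnreal), integral_add_measure (hμ n) ((hαp n).smul_measure_nnreal),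
        integral_add_measure ((hαp n).smul_measure_nnreal) ((hβp n).smul_measure_nnreal),
        integral_smul_nnreal_measure, integral_smul_nnreal_measure, integral_smul_nnreal_measure,
        integral_smul_nnreal_measure, h]
      simp only [NNReal.smul_def, smul_eq_mul, Real.coe_toNNReal']
      linear_combination -(∫ t, t ^ n ∂α) * max_zero_sub_max_neg_zero_eq_self γ -
        (∫ t, t ^ n ∂β) * max_zero_sub_max_neg_zero_eq_self ζ
    · exact (hα c).smul_measure_nnreal.add_measure (hβ c).smul_measure_nnreal
  have hs : (μ + (-γ).toNNReal • α + (-ζ).toNNReal • β).real s =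
      (γ.toNNReal • α + ζ.toNNReal • β).real s := by rw [hext]
  rw [measureReal_add_apply, measureReal_add_apply, measureReal_add_apply,
    measureReal_nnreal_smul_apply, measureReal_nnreal_smul_apply, measureReal_nnreal_smul_apply,
    measureReal_nnreal_smul_apply] at hs
  simp only [Real.coe_toNNReal'] at hs
  linear_combination hs + α.real s * max_zero_sub_max_neg_zero_eq_self γ +
    β.real s * max_zero_sub_max_neg_zero_eq_self ζ

theorem integrable_exp_abs_mul_gauss (c : ℝ) (p : ℝ[X]) :
    Integrable fun t : ℝ => Real.exp |c * t| * (p.eval t * Real.exp (-t ^ 2)) := by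
  induction p using Polynomial.induction_on' with
  | add p q hp hq =>
    simp only [eval_add, add_mul, mul_add]
    exact hp.add hq
  | monomial n b =>
    have h := integrable_rpow_mul_exp_neg_mul_sq (b := 1 / 2) (by norm_num) (s := n)
      (by have : (0 : ℝ) ≤ n := n.cast_nonneg; linarith)
    simp only [Real.rpow_natCast] at h
    refine (h.norm.const_mul (|b| * Real.exp (c ^ 2 / 2))).mono' (by fun_prop)
      (.of_forall fun t => ?_)
    -- This spends half of the Gaussian exponent, and the other half still absorbs the polynomial
    -- factor.
    have h1 : |c * t| ≤ c ^ 2 / 2 + t ^ 2 / 2 := by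
      rw [abs_le]
      constructor <;> nlinarith [sq_nonneg (c - t), sq_nonneg (c + t)]
    have h2 : Real.exp |c * t| * Real.exp (-t ^ 2) ≤
        Real.exp (c ^ 2 / 2) * Real.exp (-(1 / 2) * t ^ 2) := by
      rw [← Real.exp_add, ← Real.exp_add]
      exact Real.exp_le_exp.2 (by linarith)
    rw [eval_monomial, norm_mul, norm_mul, norm_mul, norm_mul, Real.norm_of_nonneg
      (Real.exp_pos _).le, Real.norm_of_nonneg (Real.exp_pos _).le, Real.norm_of_nonneg
      (Real.exp_pos _).le, ← Real.norm_eq_abs]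
    calc Real.exp |c * t| * (‖b‖ * ‖t ^ n‖ * Real.exp (-t ^ 2))
        = ‖b‖ * ‖t ^ n‖ * (Real.exp |c * t| * Real.exp (-t ^ 2)) := by ring
      _ ≤ ‖b‖ * ‖t ^ n‖ * (Real.exp (c ^ 2 / 2) * Real.exp (-(1 / 2) * t ^ 2)) := by gcongr
      _ = _ := by rw [Real.norm_eq_abs b]; ring

theorem integrable_exp_abs_hermiteQuadMeasure (a : ℝ) (x : Fin 2 → ℂ) (c : ℝ) :
    Integrable (fun t : ℝ => Real.exp |c * t|) (hermiteQuadMeasure a x) := by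
  rw [hermiteQuadMeasure, integrable_withDensity_iff_integrable_smul' (by
    unfold hermiteQuad; fun_prop) (by simp)]
  have h : Integrable fun t : ℝ => ((Real.exp |c * t| * hermiteQuad a x t : ℝ) : ℂ) := by
    simp only [Complex.ofReal_mul, ofReal_hermiteQuad, Finset.mul_sum]
    refine integrable_finsetSum _ fun i _ => integrable_finsetSum _ fun j _ => ?_
    refine ((integrable_exp_abs_mul_gauss c (hermiteFactor a i j)).ofReal.const_mul
      (star (x i) * x j)).congr (.of_forall fun t => ?_)
    simp only [hermiteEntry, RCLike.ofReal_mul, Complex.coe_algebraMap, Complex.ofReal_mul]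
    simp
    ring
  refine h.re.congr (.of_forall fun t => ?_)
  simp only [ENNReal.toReal_ofReal (hermiteQuad_nonneg a x t), smul_eq_mul]
  rw [mul_comm]
  exact Complex.ofReal_re _

theorem integrable_exp_abs_diracQuadMeasure (t₀ y : ℝ) (x : Fin 2 → ℂ) (c : ℝ) :
    Integrable (fun t : ℝ => Real.exp |c * t|) (diracQuadMeasure t₀ y x) :=
  (integrable_dirac (by simp)).smul_measure ENNReal.ofReal_ne_top

/-! ### Recovering the weight from its moments -/

theorem ofReal_integral_pow_of_complexMeasure {c : ComplexMeasure ℝ} {μ : Measure ℝ}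
    [IsFiniteMeasure μ] (h : ∀ s, MeasurableSet s → c s = (μ.real s : ℂ)) (n : ℕ) :
    ((∫ t, t ^ n ∂μ : ℝ) : ℂ) = complexIntegral c fun t : ℝ => (t : ℂ) ^ n := by
  rw [complexIntegral_eq_integral h, ← integral_complex_ofReal]
  simp

theorem integrable_pow_of_complexMeasure {c : ComplexMeasure ℝ} {μ : Measure ℝ}
    [IsFiniteMeasure μ] (h : ∀ s, MeasurableSet s → c s = (μ.real s : ℂ)) {n : ℕ}
    (hc : c.Integrable fun t : ℝ => (t : ℂ) ^ n) : Integrable (fun t : ℝ => t ^ n) μ := by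
  rw [VectorMeasure.Integrable, variation_eq_of_nonneg h] at hc
  refine hc.re.congr (.of_forall fun t => ?_)
  simp only [← Complex.ofReal_pow]
  exact Complex.ofReal_re _

/-- Polarization: the vectors $e_0,e_1$ give the diagonal, and $e_0+e_1$, $e_0+ie_1$ give the sum
and the difference of the off-diagonal entries. -/
theorem MatrixMeasure.ext_of_quadMeasure {W V : MatrixMeasure (Fin 2)}
    (h : ∀ x s, MeasurableSet s → W.quadMeasure x s = V.quadMeasure x s) : W = V := by
  have key : ∀ s, MeasurableSet s → W.onSet s = V.onSet s := fun s hs => by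
    have h0 := h ![1, 0] s hs
    have h1 := h ![0, 1] s hs
    have h2 := h ![1, 1] s hs
    have h3 := h ![1, Complex.I] s hs
    simp only [quadMeasure_apply, dotProduct, Matrix.mulVec, Fin.sum_univ_two] at h0 h1 h2 h3
    simp at h0 h1 h2 h3
    rw [h0, h1] at h2 h3
    have h4 : W.onSet s 0 1 = V.onSet s 0 1 := by
      linear_combination h2 / 2 - Complex.I * h3 / 2 +
        (W.onSet s 0 1 - V.onSet s 0 1 + V.onSet s 1 0 - W.onSet s 1 0) / 2 * Complex.I_mul_I
    ext i j
    fin_cases i <;> fin_cases j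
    · exact h0
    · exact h4
    · simp only [Fin.mk_one, Fin.zero_eta]
      linear_combination h2 - h4
    · exact h1
  ext i j s hs
  exact congrFun (congrFun (key s hs) i) j

theorem diracMass_hasMoments (t₀ : ℝ) (M : Matrix (Fin 2) (Fin 2) ℂ) :
    (diracMass t₀ M).HasMoments := fun m i j => by
  simpa using (diracMass_integral t₀ M i j (X ^ m)).1

theorem hermiteMassWeight_moment_eq_add (a t₀ s γ ζ : ℝ) (n : ℕ) :
    (hermiteMassWeight a t₀ s γ ζ).moment n = (γ : ℂ) • (hermiteWeight a).moment n +
      (ζ : ℂ) • (diracMass t₀ (hermiteMass a t₀ s)).moment n := by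
  ext i j
  have h1 := (hermiteMassWeight_integral a t₀ s γ ζ i j (X ^ n)).2
  rw [← (hermiteWeight_integral a i j (X ^ n)).2, ← (diracMass_integral t₀ _ i j (X ^ n)).2] at h1
  simpa [MatrixMeasure.moment] using h1

/-- Positivity of `W` turns each $x^*Wx$ into a positive measure, to which scalar determinacy
applies; no sign of `γ` or `ζ` is needed. -/
theorem eq_hermiteMassWeight_of_moment_eq {a t₀ s γ ζ : ℝ} {W : MatrixMeasure (Fin 2)}
    (hW : W.HasMoments) (hpos : ∀ S, MeasurableSet S → (W.onSet S).PosSemidef)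
    (h : ∀ n, W.moment n = (hermiteMassWeight a t₀ s γ ζ).moment n) :
    W = hermiteMassWeight a t₀ s γ ζ := by
  refine MatrixMeasure.ext_of_quadMeasure fun x S hS => ?_
  obtain ⟨μ, hμ, hμx⟩ := exists_measure_of_nonneg (c := W.quadMeasure x) fun S hS => by
    rw [MatrixMeasure.quadMeasure_apply]
    exact (hpos S hS).dotProduct_mulVec_nonneg x
  rw [hμx S hS, hermiteMassWeight_quadMeasure a t₀ s γ ζ x hS, measureReal_eq_of_moments
    (fun n => integrable_pow_of_complexMeasure hμx (MatrixMeasure.quadMeasure_moment hW x n).1)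
    (fun n => ?_) (integrable_exp_abs_hermiteQuadMeasure a x)
    (integrable_exp_abs_diracQuadMeasure t₀ (hermiteXi a t₀ s) x) S]
  rw [← Complex.ofReal_inj, Complex.ofReal_add, Complex.ofReal_mul, Complex.ofReal_mul,
    ofReal_integral_pow_of_complexMeasure hμx,
    ofReal_integral_pow_of_complexMeasure fun S hS => hermiteWeight_quadMeasure a x hS,
    ofReal_integral_pow_of_complexMeasure fun S hS => diracMass_quadMeasure a t₀ s x hS,
    (MatrixMeasure.quadMeasure_moment hW x n).2,
    (MatrixMeasure.quadMeasure_moment (hermiteWeight_hasMoments a) x n).2,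
    (MatrixMeasure.quadMeasure_moment (diracMass_hasMoments t₀ _) x n).2, h,
    hermiteMassWeight_moment_eq_add, Matrix.add_mulVec, dotProduct_add, Matrix.smul_mulVec,
    Matrix.smul_mulVec, dotProduct_smul, dotProduct_smul, smul_eq_mul, smul_eq_mul]

theorem exists_eq_hermiteMassWeight {a t₀ s : ℝ} (hs : s = 1 ∨ s = -1)
    {W : MatrixMeasure (Fin 2)} (hW : IsWeightMatrix W) (h : (hermiteOp a t₀ s).IsSymmetric W) :
    ∃ γ ζ : ℝ, W = hermiteMassWeight a t₀ s γ ζ := by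
  obtain ⟨γ, ζ, hm⟩ := exists_moment_eq_of_isSymmetric hs hW.moments
    (MatrixMeasure.moment_conjTranspose hW.moments fun S hS => (hW.posSemidef S hS).isHermitian) h
  have hpi : Real.sqrt Real.pi ≠ 0 := (Real.sqrt_pos.2 Real.pi_pos).ne'
  refine ⟨γ / Real.sqrt Real.pi, ζ, eq_hermiteMassWeight_of_moment_eq hW.moments hW.posSemidef
    fun n => ?_⟩
  -- The candidate sequence uses Gaussian moments normalized by $\sqrt\pi$, hence the division in
  -- the first coefficient.
  rw [hm, hermiteMassWeight_moment, div_mul_cancel₀ _ hpi]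

/-- Positivity of the coefficients of a weight matrix `γ W_a + ζ δ_{t₀} M(a, t₀)`. -/
theorem pos_and_nonneg_of_isWeightMatrix {a t₀ s γ ζ : ℝ}
    (h : IsWeightMatrix (hermiteMassWeight a t₀ s γ ζ)) : 0 < γ ∧ 0 ≤ ζ := by
  have hq : ∀ S, MeasurableSet S → 0 ≤ γ * (hermiteQuadMeasure a ![0, 1]).real S +
      ζ * (diracQuadMeasure t₀ (hermiteXi a t₀ s) ![0, 1]).real S := fun S hS => by
    have := (h.posSemidef S hS).dotProduct_mulVec_nonneg ![0, 1]
    rw [← MatrixMeasure.quadMeasure_apply, hermiteMassWeight_quadMeasure a t₀ s γ ζ _ hS] at this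
    exact Complex.zero_le_real.1 this
  have hac : hermiteQuadMeasure a ![0, 1] ≪ volume := withDensity_absolutelyContinuous _ _
  -- The absolutely continuous part does not charge the singleton, and the vector $(0,1)$ sees the
  -- atom with mass one.
  have hζ : 0 ≤ ζ := by
    have := hq {t₀} (measurableSet_singleton t₀)
    rw [measureReal_def (hermiteQuadMeasure a ![0, 1]), hac (by simp)] at this
    simpa [diracQuadMeasure, measureReal_def] using this
  -- A pure point mass is annihilated by the monic polynomial $X-t_0$, which contradicts
  -- nonsingularity.
  have hne : γ ≠ 0 := by
    rintro rfl
    have hu := h.nonsingular (X - C (algebraMap ℝ _ t₀)) (by simp)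
    have hz : (hermiteMassWeight a t₀ s 0 ζ).form (X - C (algebraMap ℝ _ t₀))
        (X - C (algebraMap ℝ _ t₀)) = 0 := by
      have hv : ∀ i k, MatPoly.value (X - C (algebraMap ℝ (Matrix (Fin 2) (Fin 2) ℂ) t₀)) t₀
          i k = 0 := fun i k => by
        simp [MatPoly.value]
      ext i j
      rw [MatrixMeasure.form_apply]
      refine Finset.sum_eq_zero fun k _ => Finset.sum_eq_zero fun l _ => ?_
      rw [(hermiteMassWeight_integral a t₀ s 0 ζ _ _ _).2, eval_mul,
        ← MatPoly.value_eq_eval_entry, hv]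
      simp
    rw [hz] at hu
    exact not_isUnit_zero hu
  -- Off the atom only the Gaussian part remains; along $(0,1)$ its density is $e^{-t^2}$, so it has
  -- positive mass.
  have hγ : 0 ≤ γ := by
    have h1 := hq {t₀}ᶜ (measurableSet_singleton t₀).compl
    have h2 : (diracQuadMeasure t₀ (hermiteXi a t₀ s) ![0, 1]).real {t₀}ᶜ = 0 := by
      simp [diracQuadMeasure, measureReal_def]
    have h3 : 0 < (hermiteQuadMeasure a ![0, 1]).real {t₀}ᶜ := by
      refine ENNReal.toReal_pos (fun h0 => ?_) (measure_ne_top _ _)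
      rw [hermiteQuadMeasure, withDensity_apply_eq_zero (by unfold hermiteQuad; fun_prop)] at h0
      have hs : {t : ℝ | ENNReal.ofReal (hermiteQuad a ![0, 1] t) ≠ 0} = Set.univ := by
        ext t
        simp [hermiteQuad, Real.exp_pos]
      rw [hs, Set.univ_inter, measure_compl (measurableSet_singleton t₀) (by simp)] at h0
      simp at h0
    rw [h2, mul_zero, add_zero] at h1
    exact nonneg_of_mul_nonneg_left h1 h3
  exact ⟨lt_of_le_of_ne hγ hne.symm, hζ⟩

/-! ### Monic orthogonal matrix polynomials and their eigenvalue equation -/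

section Orthogonal

variable {n : Type*} [Fintype n] [DecidableEq n] {W : MatrixMeasure n} {P : ℕ → MatPoly n}

theorem MatrixMeasure.form_zero_left (W : MatrixMeasure n) (Q : MatPoly n) : W.form 0 Q = 0 := by
  ext i j
  simp [form_apply, MatPoly.entry, complexIntegral]

theorem MatrixMeasure.form_sub_left (hW : W.HasMoments) (P P' Q : MatPoly n) :
    W.form (P - P') Q = W.form P Q - W.form P' Q := by
  rw [eq_sub_iff_add_eq, ← form_add_left hW, sub_add_cancel]

theorem MatrixMeasure.form_sum_left (hW : W.HasMoments) {ι : Type*} (s : Finset ι)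
    (P : ι → MatPoly n) (Q : MatPoly n) : W.form (∑ i ∈ s, P i) Q = ∑ i ∈ s, W.form (P i) Q := by
  classical
  induction s using Finset.induction_on with
  | empty => simp [form_zero_left]
  | insert i s hi ih => rw [Finset.sum_insert hi, Finset.sum_insert hi, form_add_left hW, ih]

theorem IsWeightMatrix.moment_conjTranspose (hW : IsWeightMatrix W) (m : ℕ) :
    (W.moment m)ᴴ = W.moment m :=
  MatrixMeasure.moment_conjTranspose hW.moments (fun S hS => (hW.posSemidef S hS).isHermitian) m

theorem IsWeightMatrix.form_conjTranspose (hW : IsWeightMatrix W) (P Q : MatPoly n) :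
    (W.form P Q)ᴴ = W.form Q P :=
  MatrixMeasure.form_conjTranspose hW.moments hW.moment_conjTranspose P Q

theorem IsWeightMatrix.form_eq_zero_comm (hW : IsWeightMatrix W) {P Q : MatPoly n}
    (h : W.form P Q = 0) : W.form Q P = 0 := by
  rw [← hW.form_conjTranspose, h, Matrix.conjTranspose_zero]

theorem IsWeightMatrix.isUnit_form_self (hW : IsWeightMatrix W) {Q : MatPoly n} (hQ : Q.Monic) :
    IsUnit (W.form Q Q) :=
  hW.nonsingular Q (by rw [hQ.leadingCoeff]; exact isUnit_one)

/-- Expansion of a matrix polynomial along a sequence of monic matrix polynomials. -/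
theorem MatPoly.exists_expansion (hP : ∀ m, (P m).Monic ∧ (P m).natDegree = m) {m : ℕ}
    {R : MatPoly n} (hR : R.degree < m) :
    ∃ A : ℕ → Matrix n n ℂ, R = ∑ k ∈ Finset.range m, C (A k) * P k := by
  induction m generalizing R with
  | zero =>
    refine ⟨0, ?_⟩
    rw [Finset.range_zero, Finset.sum_empty, ← degree_eq_bot]
    simpa using hR
  | succ m ih =>
    -- Since `P m` is monic, left multiplication by the top coefficient cancels that term, with no
    -- inversion needed.
    have hlt : (R - C (R.coeff m) * P m).degree < m := by
      rw [degree_lt_iff_coeff_zero]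
      intro k hk
      rw [coeff_sub, coeff_C_mul]
      rcases hk.eq_or_lt with rfl | hk
      · have : (P m).coeff m = 1 := by
          have := (hP m).1.coeff_natDegree
          rwa [(hP m).2] at this
        rw [this, mul_one, sub_self]
      · rw [coeff_eq_zero_of_natDegree_lt (p := P m) (by rwa [(hP m).2]), mul_zero, sub_zero]
        exact coeff_eq_zero_of_degree_lt (hR.trans_le (by exact_mod_cast hk))
    obtain ⟨A, hA⟩ := ih hlt
    refine ⟨fun k => if k = m then R.coeff m else A k, ?_⟩
    rw [Finset.sum_range_succ]
    dsimp only
    rw [if_pos rfl, ← sub_eq_iff_eq_add, hA]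
    refine Finset.sum_congr rfl fun k hk => ?_
    rw [if_neg (Finset.mem_range.1 hk).ne]

theorem IsMonicOrthogonal.form_eq_zero_of_degree_lt (hW : IsWeightMatrix W)
    (hP : IsMonicOrthogonal W P) {m : ℕ} {R : MatPoly n} (hR : R.degree < m) :
    W.form R (P m) = 0 := by
  obtain ⟨A, rfl⟩ := MatPoly.exists_expansion hP.1 hR
  rw [MatrixMeasure.form_sum_left hW.moments]
  refine Finset.sum_eq_zero fun k hk => ?_
  rw [MatrixMeasure.form_C_mul_left hW.moments, hP.2 k m (Finset.mem_range.1 hk).ne, mul_zero]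

theorem IsMonicOrthogonal.eq_zero_of_form_eq_zero (hW : IsWeightMatrix W)
    (hP : IsMonicOrthogonal W P) {m : ℕ} {R : MatPoly n} (hR : R.degree < m)
    (h : ∀ k < m, W.form R (P k) = 0) : R = 0 := by
  obtain ⟨A, rfl⟩ := MatPoly.exists_expansion hP.1 hR
  refine Finset.sum_eq_zero fun k hk => ?_
  have hk' := h k (Finset.mem_range.1 hk)
  rw [MatrixMeasure.form_sum_left hW.moments, Finset.sum_eq_single_of_mem k hk fun j _ hj => by
    rw [MatrixMeasure.form_C_mul_left hW.moments, hP.2 j k hj, mul_zero],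
    MatrixMeasure.form_C_mul_left hW.moments] at hk'
  rw [(hW.isUnit_form_self (hP.1 k).1).mul_left_eq_zero.1 hk', C_0, zero_mul]

theorem IsMonicOrthogonal.degree_le (hP : IsMonicOrthogonal W P) (m : ℕ) : (P m).degree ≤ m := by
  have := degree_le_natDegree (p := P m)
  rwa [(hP.1 m).2] at this

theorem IsMonicOrthogonal.coeff_self (hP : IsMonicOrthogonal W P) (m : ℕ) :
    (P m).coeff m = 1 := by
  have := (hP.1 m).1.coeff_natDegree
  rwa [(hP.1 m).2] at this

theorem IsMonicOrthogonal.unique (hW : IsWeightMatrix W) {P' : ℕ → MatPoly n}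
    (hP : IsMonicOrthogonal W P) (hP' : IsMonicOrthogonal W P') : P = P' := by
  funext m
  rw [← sub_eq_zero]
  refine hP.eq_zero_of_form_eq_zero hW (m := m) ?_ fun k hk => ?_
  · rw [degree_lt_iff_coeff_zero]
    intro k hk
    rcases hk.eq_or_lt with rfl | hk
    · rw [coeff_sub, hP.coeff_self, hP'.coeff_self, sub_self]
    · rw [coeff_sub, coeff_eq_zero_of_natDegree_lt (by rwa [(hP.1 m).2]),
        coeff_eq_zero_of_natDegree_lt (by rwa [(hP'.1 m).2]), sub_self]
  · rw [MatrixMeasure.form_sub_left hW.moments, hP.2 m k hk.ne',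
      hW.form_eq_zero_comm (hP'.form_eq_zero_of_degree_lt hW
        ((hP.degree_le k).trans_lt (by exact_mod_cast hk))), sub_self]

/-- The monic orthogonal polynomials given by the Gram-Schmidt process. -/
def MatrixMeasure.orthPoly (W : MatrixMeasure n) (m : ℕ) : MatPoly n :=
  X ^ m - ∑ k : Fin m, C (W.form (X ^ m) (W.orthPoly k) *
    (W.form (W.orthPoly k) (W.orthPoly k))⁻¹) * W.orthPoly k
termination_by m

theorem MatrixMeasure.orthPoly_degree_sum_lt [Nonempty n] (W : MatrixMeasure n) (m : ℕ)
    (h : ∀ k < m, (W.orthPoly k).degree = k) (A : Fin m → Matrix n n ℂ) :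
    (∑ k : Fin m, C (A k) * W.orthPoly k).degree < m := by
  refine (degree_sum_le _ _).trans_lt ((Finset.sup_lt_iff (WithBot.bot_lt_coe _)).2 fun k _ => ?_)
  refine (degree_mul_le _ _).trans_lt ?_
  rw [h k k.2]
  refine (add_le_add_left degree_C_le _).trans_lt ?_
  rw [zero_add]
  exact_mod_cast k.2

/-- No property of the weight is needed: the Gram-Schmidt correction has lower degree whatever the
matrix inverses are. Nonsingularity enters only for orthogonality. -/
theorem MatrixMeasure.orthPoly_degree [Nonempty n] (W : MatrixMeasure n) (m : ℕ) :
    (W.orthPoly m).degree = m := by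
  induction m using Nat.strong_induction_on with
  | _ m ih =>
    rw [orthPoly, degree_sub_eq_left_of_degree_lt, degree_X_pow]
    rw [degree_X_pow]
    exact W.orthPoly_degree_sum_lt m ih _

theorem MatrixMeasure.orthPoly_monic [Nonempty n] (W : MatrixMeasure n) (m : ℕ) :
    (W.orthPoly m).Monic := by
  rw [orthPoly, sub_eq_add_neg]
  refine monic_X_pow_add ?_
  rw [degree_neg]
  exact W.orthPoly_degree_sum_lt m (fun k _ => W.orthPoly_degree k) _

theorem IsWeightMatrix.form_orthPoly_of_lt [Nonempty n] (hW : IsWeightMatrix W) (m : ℕ) :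
    ∀ k < m, W.form (W.orthPoly m) (W.orthPoly k) = 0 := by
  induction m using Nat.strong_induction_on with
  | _ m ih =>
    intro k hk
    rw [MatrixMeasure.orthPoly, MatrixMeasure.form_sub_left hW.moments,
      MatrixMeasure.form_sum_left hW.moments, Finset.sum_eq_single ⟨k, hk⟩,
      MatrixMeasure.form_C_mul_left hW.moments, mul_assoc, Matrix.nonsing_inv_mul, mul_one,
      sub_self]
    · exact (Matrix.isUnit_iff_isUnit_det _).1 (hW.isUnit_form_self (W.orthPoly_monic k))
    · intro j _ hj
      rw [MatrixMeasure.form_C_mul_left hW.moments]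
      have hjk : (j : ℕ) ≠ k := fun h => hj (Fin.ext h)
      rcases hjk.lt_or_gt with h | h
      · rw [hW.form_eq_zero_comm (ih k hk j h), mul_zero]
      · rw [ih j j.2 k h, mul_zero]
    · simp

theorem IsWeightMatrix.isMonicOrthogonal_orthPoly [Nonempty n] (hW : IsWeightMatrix W) :
    IsMonicOrthogonal W W.orthPoly := by
  refine ⟨fun m => ⟨W.orthPoly_monic m, natDegree_eq_of_degree_eq_some (W.orthPoly_degree m)⟩,
    fun m k hmk => ?_⟩
  rcases hmk.lt_or_gt with h | h
  · exact hW.form_eq_zero_comm (hW.form_orthPoly_of_lt k m h)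
  · exact hW.form_orthPoly_of_lt m k h

theorem IsWeightMatrix.existsUnique_isMonicOrthogonal [Nonempty n] (hW : IsWeightMatrix W) :
    ∃! P : ℕ → MatPoly n, IsMonicOrthogonal W P :=
  ⟨_, hW.isMonicOrthogonal_orthPoly, fun _ h => h.unique hW hW.isMonicOrthogonal_orthPoly⟩

/-- Symmetry moves `D` onto `P k` with `k < m`, and `D` keeps the degree below `m`, so the image of
`P m` is orthogonal to all lower `P k`. After subtracting `C Γ * P m` the degree also drops below
`m`, which leaves only zero. -/
theorem IsMonicOrthogonal.act_eq (hW : IsWeightMatrix W) (hP : IsMonicOrthogonal W P)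
    {D : SecondOrderOp n} (hD : D.IsSymmetric W)
    (hdeg : ∀ (m : ℕ) (Q : MatPoly n), Q.degree < m → (D.act Q).degree < m) {m : ℕ}
    {Γ : Matrix n n ℂ} (hΓ : (D.act (P m)).coeff m = Γ) : D.act (P m) = C Γ * P m := by
  rw [← sub_eq_zero]
  refine hP.eq_zero_of_form_eq_zero hW (m := m) ?_ fun k hk => ?_
  -- The strict degree hypothesis is applied at `m + 1`, which expresses degree at most `m`.
  · have h1 : (D.act (P m)).degree < (m + 1 : ℕ) :=
      hdeg _ _ ((hP.degree_le m).trans_lt (by exact_mod_cast m.lt_succ_self))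
    rw [degree_lt_iff_coeff_zero]
    intro k hk
    rcases hk.eq_or_lt with rfl | hk
    · rw [coeff_sub, coeff_C_mul, hP.coeff_self, hΓ, mul_one, sub_self]
    · rw [coeff_sub, coeff_C_mul, coeff_eq_zero_of_degree_lt (h1.trans_le (by exact_mod_cast hk)),
        coeff_eq_zero_of_natDegree_lt (by rwa [(hP.1 m).2]), mul_zero, sub_self]
  · rw [MatrixMeasure.form_sub_left hW.moments, MatrixMeasure.form_C_mul_left hW.moments,
      hP.2 m k hk.ne', mul_zero, sub_zero, hD]
    exact hW.form_eq_zero_comm (hP.form_eq_zero_of_degree_lt hW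
      (hdeg m _ ((hP.degree_le k).trans_lt (by exact_mod_cast hk))))

theorem coeff_derivative_nsmul (P : MatPoly n) (k : ℕ) :
    (derivative P).coeff k = (k + 1) • P.coeff (k + 1) := by
  rw [coeff_derivative, nsmul_eq_mul']
  push_cast
  rfl

/-- Because each $F_j$ has degree at most $j$, the coefficient at `k` depends only on those at `k`,
`k + 1`, `k + 2`. This gives both the degree bound and the eigenvalue. -/
theorem SecondOrderOp.coeff_act {D : SecondOrderOp n} {a₀ a₁ a₂ b₀ b₁ c : Matrix n n ℂ}
    (h2 : D.F2 = C a₀ + C a₁ * X + C a₂ * X ^ 2) (h1 : D.F1 = C b₀ + C b₁ * X) (h0 : D.F0 = C c)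
    (P : MatPoly n) (k : ℕ) :
    (D.act P).coeff k = ((k + 1) * (k + 2)) • (P.coeff (k + 2) * a₀) +
      P.coeff (k + 1) * (((k + 1) * k) • a₁ + (k + 1) • b₀) +
      P.coeff k * ((k * (k - 1)) • a₂ + k • b₁ + c) := by
  simp only [act, h2, h1, h0, mul_add, ← mul_assoc, coeff_add, coeff_mul_C, coeff_mul_X_pow']
  rcases k with _ | _ | k
  · simp [-nsmul_eq_mul, coeff_derivative_nsmul, mul_coeff_zero]
  · simp [-nsmul_eq_mul, coeff_derivative_nsmul, coeff_mul_X]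
    module
  · simp [-nsmul_eq_mul, coeff_derivative_nsmul, coeff_mul_X, mul_add, add_assoc]
    module

end Orthogonal

/-! ### Eigenvalues, rank of the mass, and the case of a mass at the origin -/

theorem hermiteOp_degree_act (a t₀ s : ℝ) (m : ℕ) (Q : MatPoly (Fin 2)) (hQ : Q.degree < m) :
    ((hermiteOp a t₀ s).act Q).degree < m := by
  rw [degree_lt_iff_coeff_zero] at hQ ⊢
  intro k hk
  rw [SecondOrderOp.coeff_act rfl rfl rfl, hQ k hk, hQ (k + 1) (by omega), hQ (k + 2) (by omega)]
  simp

theorem hermiteOp_coeff_act_self {a t₀ s : ℝ} {W : MatrixMeasure (Fin 2)}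
    {P : ℕ → MatPoly (Fin 2)} (ha : a ≠ 0) (hP : IsMonicOrthogonal W P) (m : ℕ) :
    ((hermiteOp a t₀ s).act (P m)).coeff m = hermiteEigenvalue a t₀ s m := by
  rw [SecondOrderOp.coeff_act rfl rfl rfl, hP.coeff_self,
    coeff_eq_zero_of_natDegree_lt (by rw [(hP.1 m).2]; omega),
    coeff_eq_zero_of_natDegree_lt (by rw [(hP.1 m).2]; omega)]
  -- The natural subtraction truncates at `m = 0`, where the factor `m` vanishes anyway.
  have hc : ((m * (m - 1) : ℕ) : ℂ) = m * (m - 1) := by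
    cases m <;> simp
  ext i j
  have ha' : (a : ℂ) ≠ 0 := Complex.ofReal_ne_zero.2 ha
  fin_cases i <;> fin_cases j <;>
    simp [-nsmul_eq_mul, hermiteEigenvalue, cmat] <;> simp only [nsmul_eq_mul, hc] <;>
    field_simp <;> ring

theorem IsMonicOrthogonal.hermiteOp_act_eq {a t₀ s γ ζ : ℝ} (ha : a ≠ 0) (hs : s = 1 ∨ s = -1)
    (hγ : 0 < γ) (hζ : 0 ≤ ζ) {P : ℕ → MatPoly (Fin 2)}
    (hP : IsMonicOrthogonal (hermiteMassWeight a t₀ s γ ζ) P) (m : ℕ) :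
    (hermiteOp a t₀ s).act (P m) = C (hermiteEigenvalue a t₀ s m) * P m :=
  hP.act_eq (hermiteMassWeight_isWeightMatrix a t₀ s hγ hζ)
    (hermiteMassWeight_isSymmetric ha hs γ ζ) (hermiteOp_degree_act a t₀ s)
    (hermiteOp_coeff_act_self ha hP m)

theorem hermiteMass_rank (a t₀ s : ℝ) : (hermiteMass a t₀ s).rank = 1 := by
  have h : hermiteMass a t₀ s =
      Matrix.vecMulVec ![(hermiteXi a t₀ s : ℂ), 1] ![(hermiteXi a t₀ s : ℂ), 1] := by
    ext i j
    fin_cases i <;> fin_cases j <;> simp [hermiteMass, cmat, Matrix.vecMulVec, sq]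
  refine le_antisymm (by rw [h]; exact Matrix.rank_vecMulVec_le _ _) ?_
  rw [Nat.one_le_iff_ne_zero]
  intro h0
  rw [Matrix.rank, Submodule.finrank_eq_zero, LinearMap.range_eq_bot] at h0
  simpa [hermiteMass, cmat, Matrix.mulVec, dotProduct] using
    congrFun (LinearMap.congr_fun h0 ![0, 1]) 1

theorem hermiteOp_upsilon {a t₀ s : ℝ} (ha : a ≠ 0) (hs : s = 1 ∨ s = -1) :
    (hermiteOp a t₀ s).upsilon =
      {W | ∃ γ ζ : ℝ, 0 < γ ∧ 0 ≤ ζ ∧ W = hermiteMassWeight a t₀ s γ ζ} := by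
  ext W
  constructor
  · rintro ⟨hW, h⟩
    obtain ⟨γ, ζ, rfl⟩ := exists_eq_hermiteMassWeight hs hW h
    obtain ⟨hγ, hζ⟩ := pos_and_nonneg_of_isWeightMatrix hW
    exact ⟨γ, ζ, hγ, hζ, rfl⟩
  · rintro ⟨γ, ζ, hγ, hζ, rfl⟩
    exact ⟨hermiteMassWeight_isWeightMatrix a t₀ s hγ hζ, hermiteMassWeight_isSymmetric ha hs γ ζ⟩

theorem hermiteXi_zero (a s : ℝ) : hermiteXi a 0 s = s := by
  have : Real.sqrt 4 = 2 := by
    rw [show (4 : ℝ) = 2 ^ 2 by norm_num]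
    exact Real.sqrt_sq (by norm_num)
  simp [hermiteXi, this]

theorem hermiteOp_zero_one (a : ℝ) : hermiteOp a 0 1 = hermiteOpZero a := by
  simp [hermiteOp, hermiteOpZero, hermiteXi_zero, mul_div_assoc]

theorem hermiteMass_zero_one (a : ℝ) : hermiteMass a 0 1 = !![1, 1; 1, 1] := by
  ext i j
  fin_cases i <;> fin_cases j <;> simp [hermiteMass, hermiteXi_zero, cmat]

theorem hermiteEigenvalue_zero_one (a : ℝ) (m : ℕ) :
    hermiteEigenvalue a 0 1 m = hermiteEigenvalueZero a m := by
  simp only [hermiteEigenvalue, hermiteEigenvalueZero, hermiteXi_zero]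
  congr 1 <;> ring

end

theorem mainTheorem3 (a : ℝ) (ha : a ≠ 0) :
    (∀ t₀ s : ℝ, (s = 1 ∨ s = -1) →
      (hermiteMass a t₀ s).PosSemidef ∧ (hermiteMass a t₀ s).rank = 1 ∧
      (∀ γ ζ : ℝ, 0 < γ → 0 ≤ ζ →
        (hermiteOp a t₀ s).IsSymmetric
          (γ • hermiteWeight a + ζ • diracMass t₀ (hermiteMass a t₀ s))) ∧
      (hermiteOp a t₀ s).upsilon =
        {W | ∃ γ ζ : ℝ, 0 < γ ∧ 0 ≤ ζ ∧
          W = γ • hermiteWeight a + ζ • diracMass t₀ (hermiteMass a t₀ s)} ∧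
      (∀ γ ζ : ℝ, 0 < γ → 0 ≤ ζ →
        (∃! P : ℕ → MatPoly (Fin 2), IsMonicOrthogonal
          (γ • hermiteWeight a + ζ • diracMass t₀ (hermiteMass a t₀ s)) P) ∧
        ∀ P : ℕ → MatPoly (Fin 2), IsMonicOrthogonal
            (γ • hermiteWeight a + ζ • diracMass t₀ (hermiteMass a t₀ s)) P →
          ∀ m : ℕ, (hermiteOp a t₀ s).act (P m) =
            Polynomial.C (hermiteEigenvalue a t₀ s m) * P m)) ∧
    (hermiteOp a 0 1 = hermiteOpZero a ∧
      hermiteMass a 0 1 = !![1, 1; 1, 1] ∧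
      (∀ m : ℕ, hermiteEigenvalue a 0 1 m = hermiteEigenvalueZero a m) ∧
      (hermiteOpZero a).upsilon =
        {W | ∃ γ ζ : ℝ, 0 < γ ∧ 0 ≤ ζ ∧
          W = γ • hermiteWeight a + ζ • diracMass 0 !![1, 1; 1, 1]}) := by
  refine ⟨fun t₀ s hs => ⟨hermiteMass_posSemidef a t₀ s, hermiteMass_rank a t₀ s,
    fun γ ζ _ _ => hermiteMassWeight_isSymmetric ha hs γ ζ, hermiteOp_upsilon ha hs,
    fun γ ζ hγ hζ =>
      ⟨(hermiteMassWeight_isWeightMatrix a t₀ s hγ hζ).existsUnique_isMonicOrthogonal,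
        fun _ hP m => hP.hermiteOp_act_eq ha hs hγ hζ m⟩⟩,
    hermiteOp_zero_one a, hermiteMass_zero_one a, hermiteEigenvalue_zero_one a, ?_⟩
  rw [← hermiteOp_zero_one, hermiteOp_upsilon ha (.inl rfl)]
  simp only [hermiteMassWeight, hermiteMass_zero_one]
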